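/- Let $\mathbb{K}\subseteq\mathbb{R}$ be a subring (for instance $\mathbb{K}=\mathbb{Z},\mathbb{Q}$ or $\mathbb{R}$), let $d\ge 1$, let $X=(X_1,\dots,X_d)$ have i.i.d. standard Gaussian components, let $h\in\mathbb{K}[x_1,\dots,x_d]$ be non-constant, and put $Y=h(X)$. Let $I\subseteq\mathbb{R}$ be the support of the law of $Y$. *Polynomial Stein operators.* For a differential operator $\mathcal{S}=\sum_{t=0}^{T}p_t\partial^t$ of order $T$ with coefficients $p_t\in\mathbb{K}[y]$ of maximal degree $m$, let $\mathcal{F}_{\mathcal{S},Y}$ be the set of all $f\in C^{T}(I)$ with $\mathbb{E}|Y^jf^{(t)}(Y)|<\infty$ for all $0\le t\le T$, $0\le j\le m$. Then $PSO(Y)$ is the set of all such $\mathcal{S}$ (of any order) with $\mathcal{S}f(Y)\in L^1$ and $\mathbb{E}[\mathcal{S}f(Y)]=0$ for all $f\in\mathcal{F}_{\mathcal{S},Y}$. *Stein chains.* Let $H_n$ be the (probabilists') Hermite polynomials, $H_\alpha(x)=\prod_kH_{\alpha_k}(x_k)$, let $L^{-1}$ be the linear map on $\mathbb{R}[x_1,\dots,x_d]$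 with $L^{-1}1=0$, $L^{-1}H_\alpha=-|\alpha|^{-1}H_\alpha$ for $|\alpha|>0$, and let $\Gamma_Y(f)=-\sum_{k=1}^d\partial_{x_k}h\,\partial_{x_k}(L^{-1}f)$. For $T\ge1$ and $p_0,\dots,p_T\in\mathbb{K}[y]$ put $g_0=0$ and $g_t=\Gamma_Y(g_{t-1}+p_{t-1}(h))$ for $1\le t\le T$. The sequence $(p_0,\dots,p_T)$ is a *Stein chain* of length $T$, i.e. belongs to $SC(Y,T)$, if $\mathbb{E}[g_t(X)]=-\mathbb{E}[p_t(Y)]$ for $t=0,\dots,T$ and $g_T(X)+p_T(Y)$ is orthogonal in $L^2$ to all square integrable $\sigma(Y)$-measurable random variables. It is an *algebraic Stein chain*, i.e. belongs to $ASC(Y,T)$, if moreover $g_T(X)+p_T(Y)=0$ almost surely. An operator $\mathcal{S}=\sum_{t=0}^{T}p_t\partial^t\in PSO(Y)$ (where $T\ge 1$, and $p_T=0$ is allowed) is *algebraic of length $T$* if $(p_0,\dots,p_T)\in ASC(Y,T)$; $APSO(Y)$ is the set of all operators in $PSO(Y)$ that are algebraic of some length $T\ge1$. Then: (a) $APSO(Y)\subseteq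 PSO(Y)$. (b) If $d=1$, then $APSO(Y)=PSO(Y)$; more precisely, for every $T\ge1$, every operator in $PSO(Y)$ of order at most $T$ is algebraic of length $T$. Moreover $ASC(Y,T)=SC(Y,T)$ for every $T\ge1$. -/

import Mathlib

open MeasureTheory ProbabilityTheory

noncomputable section

namespace SteinOp

/-! ### Multivariate Hermite polynomials and the algebraic Malliavin operators on `ℝ[x₁, …, x_d]` -/

/-- The multivariate (probabilists') Hermite polynomial `H_α(x) = ∏ₖ H_{αₖ}(xₖ)`. -/
def hermiteMv (d : ℕ) (α : Fin d →₀ ℕ) : MvPolynomial (Fin d) ℝ :=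
  ∏ k, Polynomial.aeval (MvPolynomial.X k : MvPolynomial (Fin d) ℝ) (Polynomial.hermite (α k))

lemma coeff_hermiteMv (d : ℕ) (α β : Fin d →₀ ℕ) :
    (hermiteMv d α).coeff β = ∏ k, ((Polynomial.hermite (α k)).coeff (β k) : ℝ) := by
  classical
  have h1 : hermiteMv d α = ∑ i ∈ Fintype.piFinset (fun k => Finset.range (α k + 1)),
      MvPolynomial.monomial (Finsupp.equivFunOnFinite.symm i)
        (∏ k, ((Polynomial.hermite (α k)).coeff (i k) : ℝ)) := by
    unfold hermiteMv
    have h2 : ∀ k, Polynomial.aeval (MvPolynomial.X k : MvPolynomial (Fin d) ℝ)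
        (Polynomial.hermite (α k)) = ∑ j ∈ Finset.range (α k + 1),
          MvPolynomial.C ((Polynomial.hermite (α k)).coeff j : ℝ) * MvPolynomial.X k ^ j := by
      intro k
      rw [Polynomial.aeval_eq_sum_range, Polynomial.natDegree_hermite]
      refine Finset.sum_congr rfl fun j _ => ?_
      simp [zsmul_eq_mul]
    simp_rw [h2]
    rw [Finset.prod_univ_sum]
    refine Finset.sum_congr rfl fun i _ => ?_
    rw [Finset.prod_mul_distrib, MvPolynomial.monomial_eq, map_prod]
    congr 1
    rw [Finsupp.prod_fintype _ _ (by simp)]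
    rfl
  rw [h1, MvPolynomial.coeff_sum]
  simp_rw [MvPolynomial.coeff_monomial]
  by_cases hβ : ∀ k, β k ≤ α k
  · rw [Finset.sum_eq_single (β : Fin d → ℕ)]
    · simp
    · intro i _ hi
      rw [if_neg]
      rintro rfl
      exact hi rfl
    · intro h
      exact absurd (by simpa [Fintype.mem_piFinset, Nat.lt_succ_iff] using hβ) h
  · push Not at hβ
    obtain ⟨k, hk⟩ := hβ
    rw [Finset.prod_eq_zero (Finset.mem_univ k)
      (by exact_mod_cast Polynomial.coeff_hermite_of_lt hk)]
    refine Finset.sum_eq_zero fun i hi => ?_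
    rw [if_neg]
    rintro rfl
    have := Fintype.mem_piFinset.1 hi k
    simp only [Finset.mem_range, Finsupp.equivFunOnFinite_symm_apply_apply] at this hk
    omega

lemma coeff_hermiteMv_self (d : ℕ) (α : Fin d →₀ ℕ) : (hermiteMv d α).coeff α = 1 := by
  simp [coeff_hermiteMv, Polynomial.coeff_hermite_self]

lemma le_of_coeff_hermiteMv_ne_zero {d : ℕ} {α β : Fin d →₀ ℕ}
    (h : (hermiteMv d α).coeff β ≠ 0) : β ≤ α := by
  intro k
  by_contra hk
  push Not at hk
  refine h ?_
  rw [coeff_hermiteMv]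
  exact Finset.prod_eq_zero (Finset.mem_univ k)
    (by exact_mod_cast Polynomial.coeff_hermite_of_lt hk)

lemma linearIndependent_hermiteMv (d : ℕ) : LinearIndependent ℝ (hermiteMv d) := by
  classical
  rw [linearIndependent_iff']
  intro s c hc i hi
  by_contra hci
  obtain ⟨α, hα⟩ := (s.filter fun j => c j ≠ 0).exists_maximal
    ⟨i, by simp [hi, hci]⟩
  have hαs := hα.1
  simp only [Finset.mem_filter] at hαs
  have h1 := congrArg (MvPolynomial.coeff α) hc
  rw [MvPolynomial.coeff_sum, Finset.sum_eq_single α] at h1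
  · simp [coeff_hermiteMv_self] at h1
    exact hαs.2 h1
  · intro β hβ hne
    by_contra h0
    rw [MvPolynomial.coeff_smul, smul_eq_mul, mul_eq_zero, not_or] at h0
    have hle := le_of_coeff_hermiteMv_ne_zero h0.2
    exact hne (le_antisymm (hα.2 (by simp [hβ, h0.1]) hle) hle)
  · exact fun h => absurd hαs.1 h

lemma top_le_span_hermiteMv (d : ℕ) : ⊤ ≤ Submodule.span ℝ (Set.range (hermiteMv d)) := by
  classical
  have key : ∀ α : Fin d →₀ ℕ, (MvPolynomial.monomial α (1 : ℝ)) ∈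
      Submodule.span ℝ (Set.range (hermiteMv d)) := by
    intro α
    induction α using WellFoundedLT.induction with
    | ind α ih =>
      have hmem : α ∈ (hermiteMv d α).support := by
        simp [MvPolynomial.mem_support_iff, coeff_hermiteMv_self]
      have h1 := (hermiteMv d α).as_sum
      rw [← Finset.add_sum_erase _ _ hmem, coeff_hermiteMv_self] at h1
      replace h1 := eq_sub_of_add_eq h1.symm
      rw [h1]
      refine Submodule.sub_mem _ (Submodule.subset_span ⟨α, rfl⟩) ?_
      refine Submodule.sum_mem _ fun β hβ => ?_
      rw [Finset.mem_erase, MvPolynomial.mem_support_iff] at hβ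
      have hlt := lt_of_le_of_ne (le_of_coeff_hermiteMv_ne_zero hβ.2) hβ.1
      have := Submodule.smul_mem _ ((hermiteMv d α).coeff β) (ih β hlt)
      rwa [MvPolynomial.smul_monomial, smul_eq_mul, mul_one] at this
  intro p _
  rw [p.as_sum]
  refine Submodule.sum_mem _ fun β _ => ?_
  have := Submodule.smul_mem _ (p.coeff β) (key β)
  rwa [MvPolynomial.smul_monomial, smul_eq_mul, mul_one] at this

/-- The multivariate Hermite polynomials as a basis of `ℝ[x₁, …, x_d]`. -/
def hermiteBasis (d : ℕ) : Module.Basis (Fin d →₀ ℕ) ℝ (MvPolynomial (Fin d) ℝ) :=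
  Module.Basis.mk (linearIndependent_hermiteMv d) (top_le_span_hermiteMv d)

/-- The linear pseudo-inverse of the Ornstein–Uhlenbeck operator:
`L⁻¹ 1 = 0` and `L⁻¹ H_α = -|α|⁻¹ H_α` for `|α| > 0`. -/
def ouInv (d : ℕ) : MvPolynomial (Fin d) ℝ →ₗ[ℝ] MvPolynomial (Fin d) ℝ :=
  (hermiteBasis d).constr ℝ fun α =>
    if α = 0 then 0 else (-((∑ k, α k : ℕ) : ℝ)⁻¹) • hermiteMv d α

/-- The pseudo-inverse of the divergence: `δ⁻¹ f = -D L⁻¹ f`, a vector of polynomials. -/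
def divInv {d : ℕ} (f : MvPolynomial (Fin d) ℝ) (k : Fin d) : MvPolynomial (Fin d) ℝ :=
  -MvPolynomial.pderiv k (ouInv d f)

/-- The Gamma operator `Γ_y(f) = (Dh, δ⁻¹ f)` of the target `y = h(x)`. -/
def gammaOp {d : ℕ} (h f : MvPolynomial (Fin d) ℝ) : MvPolynomial (Fin d) ℝ :=
  ∑ k, MvPolynomial.pderiv k h * divInv f k

/-! ### Polynomial Stein operators -/

section Operators

variable {K : Type*} [CommRing K]

/-- The order `T` of the differential operator `∑ₜ S t ∂ᵗ` (`0` for the zero operator). -/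
def order (S : ℕ →₀ Polynomial K) : ℕ := S.support.sup id

/-- The maximal degree `m` of the coefficients of the differential operator `∑ₜ S t ∂ᵗ`. -/
def maxDegree (S : ℕ →₀ Polynomial K) : ℕ := S.support.sup fun t => (S t).natDegree

variable {Ω : Type*} [MeasurableSpace Ω]

/-- The support `I ⊆ ℝ` of (the law of) the real random variable `Y`. -/
def rvSupport (P : Measure Ω) (Y : Ω → ℝ) : Set ℝ := (P.map Y).support

/-- The class `𝓕_{S,Y}`: functions `f ∈ Cᵀ(I)` with `E|Yʲ f⁽ᵗ⁾(Y)| < ∞` for `t ≤ T`, `j ≤ m`,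
where `I` is the support of `Y`, `T` the order and `m` the maximal degree of the operator.
Only the values of `f` on `I` matter. -/
def testFunctions (P : Measure Ω) (Y : Ω → ℝ) (S : ℕ →₀ Polynomial K) : Set (ℝ → ℝ) :=
  {f | ContDiffOn ℝ (order S) f (rvSupport P Y) ∧
    ∀ t ≤ order S, ∀ j ≤ maxDegree S,
      Integrable (fun ω => Y ω ^ j * iteratedDerivWithin t f (rvSupport P Y) (Y ω)) P}

variable [Algebra K ℝ]

/-- The function `S f (y) = ∑ₜ pₜ(y) f⁽ᵗ⁾(y)` on `I`, for the operator with coefficients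
`pₜ = S t ∈ K[y]`. -/
def applyOp (I : Set ℝ) (S : ℕ →₀ Polynomial K) (f : ℝ → ℝ) (y : ℝ) : ℝ :=
  ∑ t ∈ S.support, Polynomial.aeval y (S t) * iteratedDerivWithin t f I y

/-- `PSO(Y)`: the polynomial Stein operators `∑ₜ pₜ ∂ᵗ`, `pₜ ∈ K[y]`, for the random variable `Y`,
acting on the class `𝓕_{S,Y}`. -/
def PSO (K : Type*) [CommRing K] [Algebra K ℝ] (P : Measure Ω) (Y : Ω → ℝ) :
    Set (ℕ →₀ Polynomial K) :=
  {S | ∀ f ∈ testFunctions P Y S,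
    Integrable (fun ω => applyOp (rvSupport P Y) S f (Y ω)) P ∧
      ∫ ω, applyOp (rvSupport P Y) S f (Y ω) ∂P = 0}

/-- `Z ∈ H(Y)^⊥`: `Z` is square integrable and orthogonal to all square integrable
`σ(Y)`-measurable random variables. -/
def OrthogonalTo (P : Measure Ω) (Y Z : Ω → ℝ) : Prop :=
  MemLp Z 2 P ∧ ∀ W : Ω → ℝ, Measurable[MeasurableSpace.comap Y inferInstance] W → MemLp W 2 P →
    ∫ ω, Z ω * W ω ∂P = 0

/-! ### Gaussian polynomial targets, Stein chains and algebraic Stein operators -/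

variable {d : ℕ}

/-- The random variable `q(X₁, …, X_d)`. -/
def evalRV {R : Type*} [CommRing R] [Algebra R ℝ] (X : Fin d → Ω → ℝ)
    (q : MvPolynomial (Fin d) R) : Ω → ℝ :=
  fun ω => MvPolynomial.aeval (fun k => X k ω) q

/-- The polynomial `p(h(x₁, …, x_d))`, with real coefficients. -/
def compTarget (h : MvPolynomial (Fin d) K) (p : Polynomial K) : MvPolynomial (Fin d) ℝ :=
  MvPolynomial.map (algebraMap K ℝ) (Polynomial.aeval h p)

/-- The sequence `g₀ = 0`, `gₜ = Γ_y(gₜ₋₁ + pₜ₋₁(y))` with `y = h(x)`, for `t ≤ T`. -/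
def chainPoly (h : MvPolynomial (Fin d) K) {T : ℕ} (p : Fin (T + 1) → Polynomial K)
    (t : Fin (T + 1)) : MvPolynomial (Fin d) ℝ :=
  Fin.induction (motive := fun _ => MvPolynomial (Fin d) ℝ) 0
    (fun s g => gammaOp (MvPolynomial.map (algebraMap K ℝ) h)
      (g + compTarget h (p s.castSucc))) t

/-- `SC(Y,T)`: the Stein chains of length `T` for the target `Y = h(X)`. -/
def SC (P : Measure Ω) (X : Fin d → Ω → ℝ) (h : MvPolynomial (Fin d) K) (T : ℕ) :
    Set (Fin (T + 1) → Polynomial K) :=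
  {p | (∀ t, ∫ ω, evalRV X (chainPoly h p t) ω ∂P
          = -∫ ω, Polynomial.aeval (evalRV X h ω) (p t) ∂P) ∧
    OrthogonalTo P (evalRV X h) (fun ω => evalRV X (chainPoly h p (Fin.last T)) ω
      + Polynomial.aeval (evalRV X h ω) (p (Fin.last T)))}

/-- `ASC(Y,T)`: the algebraic Stein chains of length `T` for the target `Y = h(X)`. -/
def ASC (P : Measure Ω) (X : Fin d → Ω → ℝ) (h : MvPolynomial (Fin d) K) (T : ℕ) :
    Set (Fin (T + 1) → Polynomial K) :=
  {p | p ∈ SC P X h T ∧ ∀ᵐ ω ∂P, evalRV X (chainPoly h p (Fin.last T)) ω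
      + Polynomial.aeval (evalRV X h ω) (p (Fin.last T)) = 0}

/-- The polynomial Stein operators `∑_{t=0}^T pₜ ∂ᵗ ∈ PSO(Y)` that are algebraic of length `T`. -/
def APSOLength (P : Measure Ω) (X : Fin d → Ω → ℝ) (h : MvPolynomial (Fin d) K) (T : ℕ) :
    Set (ℕ →₀ Polynomial K) :=
  {S | S ∈ PSO K P (evalRV X h) ∧ order S ≤ T ∧ (fun t : Fin (T + 1) => S t) ∈ ASC P X h T}

/-- `APSO(Y)`: the algebraic polynomial Stein operators for the target `Y = h(X)`. -/
def APSO (P : Measure Ω) (X : Fin d → Ω → ℝ) (h : MvPolynomial (Fin d) K) :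
    Set (ℕ →₀ Polynomial K) :=
  {S | ∃ T, 1 ≤ T ∧ S ∈ APSOLength P X h T}

end Operators

end SteinOp

end

noncomputable section

namespace SteinOp

open Polynomial Filter Topology

/-! ### Common zeros of bivariate polynomials along a curve -/

section Curve

variable {ι : Type*} {l : Filter ι} {x w : ι → ℝ}

/-! The inclusion of algebraic operators in all Stein operators is built into the definition; the
content is the case `d = 1`. Write `H` for the target polynomial, `φ` for the Gaussian density and
`q = g_T + p_T(H)`.

Gaussian integration by parts turns `E[a F(H)]` into `E[a] E[F(H)] + E[Γ(a) F'(H)]`. Iterating it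
(`sum_integral_eq`) rewrites the Stein identity of an operator as `∑_{s<T} c_s E[F⁽ˢ⁾(H)] + E[q
F⁽ᵀ⁾(H)] = 0`, where `c_s` is the mean of `g_s + p_s(H)`. Testing against powers kills the `c_s` one
after another, and cosines then show that `q` has zero conditional expectation given `H`
(`chain_of_forall_isTestSeq`). For a Stein chain this last property is the orthogonality assumption.

The core is `eq_zero_or_parity_of_setIntegral_eq_zero`: such a `q` vanishes unless `H` is even and
`q` is odd. If `H` has odd degree, values far out are attained once, so `q` vanishes there. If the
degree is even, a large value has exactly two preimages `u > 0 > v`, and `q φ / H'` takes the same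
value at both. Differentiating in the level and eliminating `φ` gives a second algebraic relation
between `u` and `v`, besides `H(u) = H(v)`. Two plane curves with infinitely many common points
share a component, and comparison of leading forms (`exists_frequently_add_eq`) shows that this
component is a line `u + v = c`. The growth of `φ` forces `c = 0`, whence the parities.

In the exceptional case `Γ` preserves evenness (`SteinRel.comp_neg_X`), so `q` is even as well as
odd, hence zero (`chainSeq_add_eq_zero`). -/

lemma eventually_eval_ne_zero (hx : Tendsto x l atTop) {r : ℝ[X]} (hr : r ≠ 0) :
    ∀ᶠ i in l, r.eval (x i) ≠ 0 := by
  have h1 : ∀ᶠ z in (atTop : Filter ℝ), r.eval z ≠ 0 := by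
    obtain ⟨M, hM⟩ := (r.roots.toFinset.finite_toSet).bddAbove
    filter_upwards [eventually_gt_atTop M] with z hz h0
    exact absurd (hM (by simpa [hr] using h0)) (not_le.2 hz)
  exact hx.eventually h1

/-- Pigeonhole over the finitely many prime factors: "frequently" distributes over a disjunction,
and units have no zeros. -/
lemma exists_prime_factor_frequently (P : ℝ[X][X]) (hP : P ≠ 0)
    (h : ∃ᶠ i in l, P.evalEval (x i) (w i) = 0) :
    ∃ μ : ℝ[X][X], Prime μ ∧ μ ∣ P ∧ ∃ᶠ i in l, μ.evalEval (x i) (w i) = 0 := by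
  induction P using UniqueFactorizationMonoid.induction_on_prime with
  | h₁ => exact absurd rfl hP
  | h₂ u hu =>
    refine absurd h ?_
    simp only [Filter.not_frequently]
    refine Eventually.of_forall fun i h0 => ?_
    exact (hu.map (evalEvalRingHom (x i) (w i))).ne_zero (by simpa using h0)
  | h₃ a p ha hp ih =>
    simp only [evalEval_mul, mul_eq_zero, Filter.frequently_or_distrib] at h
    rcases h with h | h
    · exact ⟨p, hp, dvd_mul_right _ _, h⟩
    · obtain ⟨μ, h1, h2, h3⟩ := ih ha h
      exact ⟨μ, h1, h2.mul_left _, h3⟩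

/-- By Gauss's lemma `μ` stays irreducible over the fraction field and stays prime to `F` there, so
the resultant with respect to the outer variable is a nonzero element of the ideal generated by the
two. -/
lemma exists_bezout_of_not_dvd {μ F : ℝ[X][X]} (hμ : Irreducible μ) (hdeg : μ.natDegree ≠ 0)
    (hF : ¬ μ ∣ F) : ∃ (a b : ℝ[X][X]) (r : ℝ[X]), r ≠ 0 ∧ μ * a + F * b = C r := by
  have hprim := hμ.isPrimitive hdeg
  have hirr := (hprim.irreducible_iff_irreducible_map_fraction_map (K := FractionRing ℝ[X])).1 hμ
  have hcop : IsCoprime (μ.map (algebraMap ℝ[X] (FractionRing ℝ[X])))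
      (F.map (algebraMap ℝ[X] (FractionRing ℝ[X]))) := by
    rw [hirr.coprime_iff_not_dvd]
    exact fun h => hF (hprim.dvd_of_fraction_map_dvd_fraction_map h)
  have hinj := FaithfulSMul.algebraMap_injective ℝ[X] (FractionRing ℝ[X])
  have hres : resultant μ F ≠ 0 := by
    intro h0
    have h1 := resultant_map_map μ F μ.natDegree F.natDegree
      (algebraMap ℝ[X] (FractionRing ℝ[X]))
    refine resultant_ne_zero _ _ hcop ?_
    rw [natDegree_map_eq_of_injective hinj, natDegree_map_eq_of_injective hinj, h1, h0, map_zero]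
  obtain ⟨a, b, -, -, h⟩ := exists_mul_add_mul_eq_C_resultant μ F le_rfl le_rfl (Or.inl hdeg)
  exact ⟨a, b, _, hres, h⟩

/-- Otherwise elimination yields a nonzero polynomial in `x` alone that vanishes at arbitrarily
large `x i`. In `evalEval (x i) (w i)` the coefficients are taken at `x i` and the outer variable at
`w i`. -/
lemma dvd_of_frequently_common_zero (hx : Tendsto x l atTop) {μ F : ℝ[X][X]} (hμ : Prime μ)
    (h0 : ∃ᶠ i in l, μ.evalEval (x i) (w i) = 0)
    (hF : ∀ᶠ i in l, F.evalEval (x i) (w i) = 0) : μ ∣ F := by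
  by_contra hdvd
  obtain ⟨a, b, r, hr, h⟩ : ∃ (a b : ℝ[X][X]) (r : ℝ[X]), r ≠ 0 ∧ μ * a + F * b = C r := by
    by_cases hdeg : μ.natDegree = 0
    · rw [natDegree_eq_zero] at hdeg
      obtain ⟨r, rfl⟩ := hdeg
      exact ⟨1, 0, r, by rintro rfl; exact hμ.ne_zero C_0, by simp⟩
    · exact exists_bezout_of_not_dvd hμ.irreducible hdeg hdvd
  obtain ⟨i, h1, h2, h3⟩ := (h0.and_eventually (hF.and (eventually_eval_ne_zero hx hr))).exists
  have := congrArg (evalEval (x i) (w i)) h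
  simp [evalEval_add, evalEval_mul, h1, h2, evalEval_C] at this
  exact h3 this.symm

end Curve

/-! ### Leading forms of bivariate polynomials -/

/-- The substitution `p(x, y) ↦ p(z, t z)`, with values in `ℝ[t][z]`. -/
def homogenize : ℝ[X][X] →+* ℝ[X][X] :=
  eval₂RingHom (mapRingHom C) (C X * X)

lemma evalEval_homogenize (s z : ℝ) (p : ℝ[X][X]) :
    (homogenize p).evalEval s z = p.evalEval z (s * z) := by
  have : (evalEvalRingHom s z).comp homogenize = evalEvalRingHom z (s * z) := by
    refine ringHom_ext (fun r => ?_) ?_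
    · simp [homogenize]
    · simp [homogenize, mul_comm z s]
  exact DFunLike.congr_fun this p

lemma coeff_homogenize_map (p : ℝ[X]) (k : ℕ) :
    (homogenize (p.map C)).coeff k = monomial k (p.coeff k) := by
  induction p using Polynomial.induction_on' with
  | add p q hp hq => simp [hp, hq]
  | monomial n a =>
    simp only [homogenize, coe_eval₂RingHom, map_monomial, eval₂_monomial, coe_mapRingHom, map_C,
      mul_pow, ← C_pow, ← mul_assoc, ← C_mul, coeff_C_mul, coeff_X_pow, coeff_monomial]
    by_cases h : k = n
    · subst h; simp [C_mul_X_pow_eq_monomial]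
    · simp [h, Ne.symm h]

lemma homogenize_C (p : ℝ[X]) : homogenize (C p) = p.map C := by
  simp [homogenize]

/-- The coefficient of `z^k` is the homogeneous part of total degree `k`, dehomogenized by `t = y /
x`. -/
lemma natDegree_coeff_homogenize_le (p : ℝ[X][X]) (k : ℕ) :
    ((homogenize p).coeff k).natDegree ≤ k := by
  induction p using Polynomial.induction_on' with
  | add p q hp hq =>
    rw [map_add, coeff_add]
    exact (natDegree_add_le _ _).trans (max_le hp hq)
  | monomial n a =>
    simp only [homogenize, coe_eval₂RingHom, eval₂_monomial, coe_mapRingHom, mul_pow, ← C_pow]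
    rw [mul_left_comm, coeff_C_mul, coeff_mul_X_pow', coeff_map]
    split_ifs with h
    · refine natDegree_mul_le.trans ?_
      simpa using h
    · simp

lemma natDegree_homogenize_map_le (p : ℝ[X]) : (homogenize (p.map C)).natDegree ≤ p.natDegree := by
  rw [natDegree_le_iff_coeff_eq_zero]
  intro k hk
  rw [coeff_homogenize_map, coeff_eq_zero_of_natDegree_lt hk, map_zero]

lemma coeff_zero_homogenize (p : ℝ[X][X]) :
    (homogenize p).coeff 0 = C (p.evalEval 0 0) := by
  obtain ⟨c, hc⟩ := natDegree_eq_zero.1 (Nat.le_zero.1 (natDegree_coeff_homogenize_le p 0))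
  have h := evalEval_homogenize 0 0 p
  rw [mul_zero] at h
  rw [← h, ← hc, evalEval]
  have : eval (C 0) (homogenize p) = (homogenize p).coeff 0 := by
    rw [C_0, coeff_zero_eq_eval_zero]
  rw [this, ← hc, eval_C]

/-- A root `t` of `p` satisfies `tⁿ = 1`, `t ≠ 0`, `t ≠ 1` and `tⁿ⁻² = 1`, hence `t² = 1` and `t =
-1`. For `n = 2` the geometric sum is already `1 + t`. -/
lemma dvd_X_add_one_of_dvd_geom_sum {n : ℕ} (hn : 2 ≤ n) {ν : ℕ} {p : ℝ[X]}
    (h1 : p ∣ ∑ i ∈ Finset.range n, X ^ i) (h2 : n ≠ 2 → p ∣ X ^ ν * (1 - X ^ (n - 2))) :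
    p ∣ X + 1 := by
  by_cases hn2 : n = 2
  · subst hn2
    simpa [Finset.sum_range_succ, add_comm] using h1
  have hX : IsCoprime p (X ^ ν) := by
    refine IsCoprime.of_isCoprime_of_dvd_left (IsCoprime.pow_right ?_) h1
    obtain ⟨m, rfl⟩ : ∃ m, n = m + 1 := ⟨n - 1, by omega⟩
    rw [geom_sum_succ]
    exact ⟨1, -∑ i ∈ Finset.range m, X ^ i, by ring⟩
  have hX1 : IsCoprime p (X - C 1) := by
    refine IsCoprime.of_isCoprime_of_dvd_left (IsCoprime.symm ?_) h1
    rw [(irreducible_X_sub_C (1 : ℝ)).coprime_iff_not_dvd, dvd_iff_isRoot]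
    simp [IsRoot, eval_finsetSum]
    omega
  have h3 : p ∣ X ^ n - 1 := h1.trans ⟨X - 1, (geom_sum_mul _ _).symm⟩
  have h4 := hX.dvd_of_dvd_mul_left (h2 hn2)
  refine hX1.dvd_of_dvd_mul_left ?_
  obtain ⟨m, rfl⟩ : ∃ m, n = m + 2 := ⟨n - 2, by omega⟩
  rw [Nat.add_sub_cancel] at h4
  have h5 := (h4.mul_left (X ^ 2)).add h3
  have : (X : ℝ[X]) ^ 2 * (1 - X ^ m) + (X ^ (m + 2) - 1) = (X - C 1) * (X + 1) := by
    rw [C_1]; ring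
  rwa [this] at h5

/-- If two distinct points of a level set of `H` are mapped by the rational function `D / N` to the
same value along a curve tending to infinity, then infinitely often the two points are conjugate
under a fixed reflection. -/
theorem exists_frequently_add_eq {ι : Type*} {l : Filter ι} [l.NeBot] {x w : ι → ℝ}
    (hx : Tendsto x l atTop) {H N D : ℝ[X]} (hn : 2 ≤ H.natDegree) (hN : N ≠ 0) (hD : D ≠ 0)
    (hdeg : D.natDegree + 2 = N.natDegree + H.natDegree)
    (hne : ∀ᶠ i in l, w i ≠ x i) (hH : ∀ᶠ i in l, H.eval (w i) = H.eval (x i))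
    (hND : ∀ᶠ i in l, N.eval (w i) * D.eval (x i) = N.eval (x i) * D.eval (w i)) :
    ∃ c : ℝ, ∃ᶠ i in l, w i = c - x i := by
  set n := H.natDegree with hn'
  have hH0 : H ≠ 0 := by rintro rfl; simp at hn'; omega
  -- `G` is the divided difference `(H(y) - H(x)) / (y - x)`; it vanishes at `(x i, w i)` because `w
  -- i ≠ x i`.
  obtain ⟨G, hG⟩ : (X - C X : ℝ[X][X]) ∣ H.map C - C H := by
    rw [dvd_iff_isRoot]
    simp [IsRoot, eval_map]
  have hfirst : (H.map C - C H : ℝ[X][X]) ≠ 0 := by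
    intro h0
    have := congrArg (fun p => coeff p n) h0
    simp [coeff_C, show H.natDegree ≠ 0 by omega, hn', hH0] at this
  have hG0 : G ≠ 0 := by rintro rfl; simp [hfirst] at hG
  have hGz : ∀ᶠ i in l, G.evalEval (x i) (w i) = 0 := by
    filter_upwards [hne, hH] with i h1 h2
    have := congrArg (evalEval (x i) (w i)) hG
    simp [evalEval_mul, evalEval_sub, evalEval_map_C, evalEval_C, h2, sub_eq_zero, h1] at this
    exact this
  obtain ⟨μ, hμ, ⟨G', hG'⟩, hμz⟩ := exists_prime_factor_frequently G hG0 hGz.frequently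
  have hμF : μ ∣ N.map C * C D - C N * D.map C := by
    refine dvd_of_frequently_common_zero hx hμ hμz ?_
    filter_upwards [hND] with i h
    simp [evalEval_mul, evalEval_sub, evalEval_map_C, evalEval_C, h]
  have ha : H.leadingCoeff ≠ 0 := leadingCoeff_ne_zero.2 hH0
  have hXn : (X ^ n - 1 : ℝ[X]).natDegree = n := by
    simpa using natDegree_X_pow_sub_C (n := n) (r := (1 : ℝ))
  have hXn0 : (X ^ n - 1 : ℝ[X]) ≠ 0 := by
    intro h0; rw [h0, natDegree_zero] at hXn; omega
  have hlev : (homogenize (H.map C - C H)).coeff n = C H.leadingCoeff * (X ^ n - 1) := by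
    rw [map_sub, coeff_sub, coeff_homogenize_map, homogenize_C, coeff_map,
      ← C_mul_X_pow_eq_monomial, leadingCoeff]
    ring
  have hlev0 : (homogenize (H.map C - C H)).coeff n ≠ 0 := by
    rw [hlev]
    exact mul_ne_zero (by simpa using hH0) hXn0
  have hlevdeg : (homogenize (H.map C - C H)).natDegree = n := by
    refine natDegree_eq_of_le_of_coeff_ne_zero ?_ hlev0
    rw [map_sub, homogenize_C]
    exact (natDegree_sub_le _ _).trans
      (max_le (natDegree_homogenize_map_le H) (natDegree_map_le))
  have hdiag : homogenize (X - C X) = C (X - 1) * X := by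
    simp [homogenize]
    ring
  have hfact : homogenize (H.map C - C H) =
      C (X - 1) * X * (homogenize μ * homogenize G') := by
    rw [hG, map_mul, hdiag, hG', map_mul]
  have hne0 : homogenize (H.map C - C H) ≠ 0 := fun h0 => hlev0 (by rw [h0, coeff_zero])
  have hX1 : (X - 1 : ℝ[X]) ≠ 0 := X_sub_C_ne_zero (1 : ℝ)
  have hμ0 : homogenize μ ≠ 0 := by
    intro h0; rw [h0, zero_mul, mul_zero] at hfact; exact hne0 hfact
  have hG'0 : homogenize G' ≠ 0 := by
    intro h0; rw [h0, mul_zero, mul_zero] at hfact; exact hne0 hfact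
  have hCX : (C (X - 1) * X : ℝ[X][X]) ≠ 0 := mul_ne_zero (C_ne_zero.2 hX1) X_ne_zero
  have hd : (homogenize μ).natDegree + (homogenize G').natDegree + 1 = n := by
    rw [← hlevdeg, hfact, natDegree_mul hCX (mul_ne_zero hμ0 hG'0), natDegree_mul hμ0 hG'0,
      natDegree_C_mul_X _ hX1, add_comm]
  have hlc : (homogenize μ).leadingCoeff * (homogenize G').leadingCoeff =
      C H.leadingCoeff * ∑ i ∈ Finset.range n, X ^ i := by
    refine mul_left_cancel₀ hX1 ?_
    have h1 := congrArg leadingCoeff hfact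
    rw [leadingCoeff, hlevdeg, hlev, leadingCoeff_mul, leadingCoeff_mul, leadingCoeff_mul,
      leadingCoeff_C, leadingCoeff_X, mul_one] at h1
    rw [← h1, mul_left_comm, mul_geom_sum]
  set M := (homogenize μ).leadingCoeff with hM
  set M' := (homogenize G').leadingCoeff with hM'
  have hM0 : M ≠ 0 := leadingCoeff_ne_zero.2 hμ0
  have hM'0 : M' ≠ 0 := leadingCoeff_ne_zero.2 hG'0
  -- The leading form of `H(y) - H(x)` is proportional to `tⁿ - 1`, of full degree `n` in `t`. The
  -- degree bounds for the two factors must therefore both be equalities.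
  have hMdeg : M.natDegree = (homogenize μ).natDegree := by
    have h1 : M.natDegree ≤ (homogenize μ).natDegree := natDegree_coeff_homogenize_le _ _
    have h2 : M'.natDegree ≤ (homogenize G').natDegree := natDegree_coeff_homogenize_le _ _
    have h3 : M.natDegree + M'.natDegree + 1 = n := by
      have h4 := congrArg natDegree (congrArg ((X - 1) * ·) hlc)
      rw [mul_left_comm (X - 1) (C _), mul_geom_sum, natDegree_C_mul ha, hXn,
        natDegree_mul hX1 (mul_ne_zero hM0 hM'0), natDegree_mul hM0 hM'0,
        ← C_1, natDegree_X_sub_C] at h4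
      omega
    omega
  have hMdvd : M ∣ X + 1 := by
    refine dvd_X_add_one_of_dvd_geom_sum hn (ν := N.natDegree) ?_ fun hn2 => ?_
    · rw [← (isUnit_C.2 ha.isUnit).dvd_mul_left, ← hlc]
      exact dvd_mul_right _ _
    -- By `hdeg` the degrees of `D` and `N` differ by `n - 2`, so the leading form is a multiple of
    -- `t^ν (1 - tⁿ⁻²)`. It is nonzero exactly because `n ≠ 2`.
    · have hc : (homogenize (N.map C * C D - C N * D.map C)).coeff (N.natDegree + D.natDegree) =
          C (N.leadingCoeff * D.leadingCoeff) * (X ^ N.natDegree * (1 - X ^ (n - 2))) := by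
        rw [map_sub, coeff_sub, map_mul, map_mul, homogenize_C, homogenize_C,
          coeff_mul_add_eq_of_natDegree_le (natDegree_homogenize_map_le N) natDegree_map_le,
          coeff_mul_add_eq_of_natDegree_le natDegree_map_le (natDegree_homogenize_map_le D),
          coeff_homogenize_map, coeff_homogenize_map, coeff_map, coeff_map,
          ← C_mul_X_pow_eq_monomial, ← C_mul_X_pow_eq_monomial, C_mul, leadingCoeff, leadingCoeff,
          show (X : ℝ[X]) ^ D.natDegree = X ^ N.natDegree * X ^ (n - 2) by
            rw [← pow_add]; congr 1; omega]
        ring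
      have hlcF : (homogenize (N.map C * C D - C N * D.map C)).leadingCoeff =
          C (N.leadingCoeff * D.leadingCoeff) * (X ^ N.natDegree * (1 - X ^ (n - 2))) := by
        rw [← hc, leadingCoeff]
        congr 1
        refine natDegree_eq_of_le_of_coeff_ne_zero ?_ ?_
        · rw [map_sub, map_mul, map_mul, homogenize_C, homogenize_C]
          exact (natDegree_sub_le _ _).trans (max_le
            (natDegree_mul_le_of_le (natDegree_homogenize_map_le N) natDegree_map_le)
            (natDegree_mul_le_of_le natDegree_map_le (natDegree_homogenize_map_le D)))
        · rw [hc]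
          refine mul_ne_zero (by simp [hN, hD]) (mul_ne_zero (pow_ne_zero _ X_ne_zero) ?_)
          intro h0
          have h5 := congrArg natDegree (sub_eq_zero.1 h0)
          rw [natDegree_one, natDegree_X_pow] at h5
          omega
      obtain ⟨F', hF'⟩ := hμF
      rw [← (isUnit_C.2 (mul_ne_zero (leadingCoeff_ne_zero.2 hN)
        (leadingCoeff_ne_zero.2 hD)).isUnit).dvd_mul_left, ← hlcF, hF', map_mul, leadingCoeff_mul]
      exact dvd_mul_right _ _
  obtain ⟨r, hr⟩ := hMdvd
  have hX10 : (X + 1 : ℝ[X]) ≠ 0 := X_add_C_ne_zero (1 : ℝ)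
  have hr0 : r ≠ 0 := by rintro rfl; simp [hX10] at hr
  have hMr : M.natDegree + r.natDegree = 1 := by
    rw [← natDegree_mul hM0 hr0, ← hr, ← C_1, natDegree_X_add_C]
  have hzero : ∃ᶠ i in l, x i ≠ 0 ∧ (homogenize μ).evalEval (w i / x i) (x i) = 0 := by
    refine (hμz.and_eventually (hx.eventually_ne_atTop 0)).mono fun i hi => ⟨hi.2, ?_⟩
    rw [evalEval_homogenize, div_mul_cancel₀ _ hi.2, hi.1]
  have hform : homogenize μ = C ((homogenize μ).coeff 1) * X + C (C (μ.evalEval 0 0)) := by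
    rw [← coeff_zero_homogenize]
    -- The leading form `M` divides `t + 1` and has the same degree as `homogenize μ`, so `μ` has
    -- total degree at most one: it defines a line.
    exact eq_X_add_C_of_natDegree_le_one (by omega)
  generalize μ.evalEval 0 0 = e at hform
  by_cases hd1 : (homogenize μ).natDegree = 1
  · have hrC := eq_C_of_natDegree_eq_zero (show r.natDegree = 0 by omega)
    refine ⟨-(e * r.coeff 0), hzero.mono fun i hi => ?_⟩
    have h1 : M = (homogenize μ).coeff 1 := by rw [hM, leadingCoeff, hd1]
    rw [hform, ← h1] at hi
    have h2 := congrArg (eval (w i / x i)) hr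
    rw [hrC] at h2
    simp [evalEval] at h2 hi
    have h3 : w i = w i / x i * x i := (div_mul_cancel₀ _ hi.1).symm
    rw [h3]
    linear_combination x i * h2 + r.coeff 0 * hi.2
  -- In degree zero `μ` would be a constant with a zero.
  · obtain ⟨i, -, hi⟩ := hzero.exists
    rw [coeff_eq_zero_of_natDegree_lt (by omega), C_0, zero_mul, zero_add] at hform
    rw [hform] at hi
    simp [evalEval] at hi
    rw [hi] at hform
    simp at hform
    exact absurd hform hμ0

/-! ### Polynomials under the standard Gaussian measure -/

lemma hasDerivAt_gaussianPDFReal_zero_one (x : ℝ) :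
    HasDerivAt (gaussianPDFReal 0 1) (-x * gaussianPDFReal 0 1 x) x := by
  rw [gaussianPDFReal_def]
  have h1 : HasDerivAt (fun x : ℝ => -(x - 0) ^ 2 / (2 * ((1 : NNReal) : ℝ))) (-x) x := by
    have := ((((hasDerivAt_id x).sub_const 0).pow 2).neg).div_const (2 * ((1 : NNReal) : ℝ))
    refine this.congr_deriv ?_
    simp
    ring
  refine (h1.exp.const_mul _).congr_deriv ?_
  ring

lemma continuous_gaussianPDFReal_zero_one : Continuous (gaussianPDFReal 0 1) :=
  continuous_iff_continuousAt.2 fun x => (hasDerivAt_gaussianPDFReal_zero_one x).continuousAt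

lemma gaussianPDFReal_zero_one_pos (x : ℝ) : 0 < gaussianPDFReal 0 1 x :=
  gaussianPDFReal_pos 0 1 x one_ne_zero

lemma integrable_eval_gaussianReal (p : ℝ[X]) :
    Integrable (fun x => p.eval x) (gaussianReal 0 1) := by
  induction p using Polynomial.induction_on' with
  | add p q hp hq =>
    simp only [eval_add]
    exact hp.add hq
  | monomial n a =>
    simp only [eval_monomial]
    refine Integrable.const_mul ?_ _
    by_cases hn : n = 0
    · simp [hn]
    · have h1 : MemLp (id : ℝ → ℝ) (n : ENNReal) (gaussianReal 0 1) := by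
        simpa using memLp_id_gaussianReal (μ := 0) (v := 1) (n : NNReal)
      have := h1.integrable_norm_pow hn
      refine this.mono (by fun_prop) (ae_of_all _ fun x => by simp)

lemma setIntegral_gaussianReal_eq {s : Set ℝ} (hs : MeasurableSet s) (f : ℝ → ℝ) :
    ∫ x in s, f x ∂(gaussianReal 0 1) = ∫ x in s, f x * gaussianPDFReal 0 1 x := by
  rw [← integral_indicator hs, integral_gaussianReal_eq_integral_smul one_ne_zero,
    ← integral_indicator hs]
  refine integral_congr_ae (ae_of_all _ fun x => ?_)
  by_cases hx : x ∈ s <;> simp [hx, mul_comm]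

/-- The primitive, vanishing at `0`, of a polynomial times the standard Gaussian density. -/
def gaussPrim (q : ℝ[X]) (x : ℝ) : ℝ := ∫ t in (0 : ℝ)..x, q.eval t * gaussianPDFReal 0 1 t

lemma hasDerivAt_gaussPrim (q : ℝ[X]) (x : ℝ) :
    HasDerivAt (gaussPrim q) (q.eval x * gaussianPDFReal 0 1 x) x := by
  have hc : Continuous fun t => q.eval t * gaussianPDFReal 0 1 t :=
    q.continuous.mul continuous_gaussianPDFReal_zero_one
  exact intervalIntegral.integral_hasDerivAt_right (hc.intervalIntegrable _ _)
    (hc.stronglyMeasurableAtFilter _ _) hc.continuousAt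

lemma setIntegral_Ioc_gaussianReal (q : ℝ[X]) {a b : ℝ} (hab : a ≤ b) :
    ∫ x in Set.Ioc a b, q.eval x ∂(gaussianReal 0 1) = gaussPrim q b - gaussPrim q a := by
  have hc : Continuous fun t => q.eval t * gaussianPDFReal 0 1 t :=
    q.continuous.mul continuous_gaussianPDFReal_zero_one
  rw [setIntegral_gaussianReal_eq measurableSet_Ioc, ← intervalIntegral.integral_of_le hab,
    gaussPrim, gaussPrim, intervalIntegral.integral_interval_sub_left
      (hc.intervalIntegrable _ _) (hc.intervalIntegrable _ _)]

lemma setIntegral_Icc_gaussianReal (q : ℝ[X]) {a b : ℝ} (hab : a ≤ b) :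
    ∫ x in Set.Icc a b, q.eval x ∂(gaussianReal 0 1) = gaussPrim q b - gaussPrim q a := by
  rw [← setIntegral_Ioc_gaussianReal q hab, setIntegral_gaussianReal_eq measurableSet_Icc,
    setIntegral_gaussianReal_eq measurableSet_Ioc, integral_Icc_eq_integral_Ioc]

/-! ### Behaviour of a polynomial near infinity -/

lemma eventually_eval_pos {p : ℝ[X]} (hp : 0 < p.leadingCoeff) : ∀ᶠ x in atTop, 0 < p.eval x := by
  by_cases h : p.natDegree = 0
  · obtain ⟨c, rfl⟩ := natDegree_eq_zero.1 h
    exact Eventually.of_forall fun x => by simpa using hp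
  · exact (tendsto_atTop_of_leadingCoeff_nonneg p (natDegree_pos_iff_degree_pos.1 (by omega))
      hp.le).eventually_gt_atTop 0

lemma leadingCoeff_derivative_real {p : ℝ[X]} (hp : p.natDegree ≠ 0) :
    (derivative p).leadingCoeff = p.leadingCoeff * p.natDegree := by
  obtain ⟨m, hm⟩ : ∃ m, p.natDegree = m + 1 := ⟨p.natDegree - 1, by omega⟩
  rw [leadingCoeff, natDegree_derivative, hm, Nat.add_sub_cancel, coeff_derivative, leadingCoeff,
    hm]
  push_cast
  ring

lemma eventually_forall_ge_derivative_pos {p : ℝ[X]} (hp : p.natDegree ≠ 0)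
    (hlc : 0 < p.leadingCoeff) : ∀ᶠ M in atTop, ∀ x ≥ M, 0 < (derivative p).eval x := by
  have h1 : 0 < (derivative p).leadingCoeff := by
    rw [leadingCoeff_derivative_real hp]
    exact mul_pos hlc (by exact_mod_cast Nat.pos_of_ne_zero hp)
  exact eventually_forall_ge_atTop.2 (eventually_eval_pos h1)

lemma strictMonoOn_Ici_of_derivative_pos {p : ℝ[X]} {M : ℝ}
    (h : ∀ x ≥ M, 0 < (derivative p).eval x) :
    StrictMonoOn (fun x => p.eval x) (Set.Ici M) := by
  refine strictMonoOn_of_deriv_pos (convex_Ici M) p.continuous.continuousOn fun x hx => ?_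
  rw [interior_Ici] at hx
  simpa using h x (le_of_lt hx)

lemma exists_gt_eval_eq {p : ℝ[X]} (hp : p.natDegree ≠ 0) (hlc : 0 < p.leadingCoeff) {M y : ℝ}
    (hy : p.eval M < y) : ∃ x, M < x ∧ p.eval x = y := by
  have h1 := tendsto_atTop_of_leadingCoeff_nonneg p
    (natDegree_pos_iff_degree_pos.1 (Nat.pos_of_ne_zero hp)) hlc.le
  obtain ⟨x1, hx1, hM⟩ := ((h1.eventually_ge_atTop y).and (eventually_ge_atTop M)).exists
  obtain ⟨x, hx, hxy⟩ := intermediate_value_Icc hM p.continuous.continuousOn ⟨hy.le, hx1⟩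
  refine ⟨x, lt_of_le_of_ne hx.1 ?_, hxy⟩
  rintro rfl
  exact hy.ne hxy

lemma leadingCoeff_comp_neg_X (p : ℝ[X]) :
    (p.comp (-X)).leadingCoeff = p.leadingCoeff * (-1) ^ p.natDegree := by
  rw [leadingCoeff_comp (by simp)]
  simp

lemma natDegree_comp_neg_X (p : ℝ[X]) : (p.comp (-X)).natDegree = p.natDegree := by
  rw [natDegree_comp]; simp

lemma eval_derivative_comp_neg_X (p : ℝ[X]) (x : ℝ) :
    (derivative (p.comp (-X))).eval x = -(derivative p).eval (-x) := by
  simp [derivative_comp]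

lemma eq_of_frequently_eval_eq {ι : Type*} {l : Filter ι} {x : ι → ℝ} (hx : Tendsto x l atTop)
    {p q : ℝ[X]} (h : ∃ᶠ i in l, p.eval (x i) = q.eval (x i)) : p = q := by
  by_contra hne
  obtain ⟨i, h1, h2⟩ :=
    (h.and_eventually (eventually_eval_ne_zero hx (sub_ne_zero.2 hne))).exists
  exact h2 (by rw [eval_sub, h1, sub_self])

lemma HasDerivAt.eq_of_eqOn_Ioi {f g : ℝ → ℝ} {f' g' B y : ℝ} (hf : HasDerivAt f f' y)
    (hg : HasDerivAt g g' y) (hy : B < y) (h : ∀ z, B < z → f z = g z) : f' = g' :=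
  (hf.congr_of_eventuallyEq ((eventually_gt_nhds hy).mono fun z hz => (h z hz).symm)).unique hg

lemma derivative_ne_zero_of_natDegree_ne_zero {p : ℝ[X]} (hp : p.natDegree ≠ 0) :
    derivative p ≠ 0 :=
  fun h => hp (derivative_eq_zero.1 h)

/-- Odd degree: a large value is attained only once. -/
lemma eq_zero_of_setIntegral_eq_zero_of_odd {H q : ℝ[X]} (hodd : Odd H.natDegree)
    (hlc : 0 < H.leadingCoeff)
    (hq : ∀ A : Set ℝ, MeasurableSet A →
      ∫ x in (fun x => H.eval x) ⁻¹' A, q.eval x ∂(gaussianReal 0 1) = 0) : q = 0 := by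
  have hn : H.natDegree ≠ 0 := hodd.pos.ne'
  have hn' : (-(H.comp (-X))).natDegree ≠ 0 := by rwa [natDegree_neg, natDegree_comp_neg_X]
  have hlc' : 0 < (-(H.comp (-X))).leadingCoeff := by
    rw [leadingCoeff_neg, leadingCoeff_comp_neg_X, hodd.neg_one_pow]; linarith
  obtain ⟨M, ⟨h1, h2⟩, hM⟩ := (((eventually_forall_ge_derivative_pos hn hlc).and
    (eventually_forall_ge_derivative_pos hn' hlc')).and (eventually_gt_atTop 0)).exists
  have hmono := strictMonoOn_Ici_of_derivative_pos h1
  have hmono' := strictMonoOn_Ici_of_derivative_pos h2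
  obtain ⟨B, hB⟩ := (isCompact_Icc (a := -M) (b := M)).bddAbove_image
    (f := fun x => H.eval x) H.continuous.continuousOn
  have hB' : ∀ z, -M ≤ z → z ≤ M → H.eval z ≤ B := fun z h3 h4 =>
    hB ⟨z, ⟨h3, h4⟩, rfl⟩
  -- `-H(-x)` also increases beyond `M`, so `H` stays below its bound on `[-M, M]` all the way to
  -- `-∞`.
  have hBneg : ∀ z, z ≤ M → H.eval z ≤ B := by
    intro z hz
    by_cases h3 : -M ≤ z
    · exact hB' z h3 hz
    · have := hmono' (Set.mem_Ici.2 le_rfl) (Set.mem_Ici.2 (show M ≤ -z by linarith))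
        (show M < -z by linarith)
      simp at this
      linarith [hB' (-M) le_rfl (by linarith)]
  obtain ⟨x0, hx0, hx0B⟩ := ((eventually_gt_atTop M).and
    ((tendsto_atTop_of_leadingCoeff_nonneg H
      (natDegree_pos_iff_degree_pos.1 (Nat.pos_of_ne_zero hn)) hlc.le).eventually_gt_atTop B)).exists
  have hpre : ∀ a, x0 ≤ a → ∀ b, a ≤ b →
      (fun x => H.eval x) ⁻¹' (Set.Ioc (H.eval a) (H.eval b)) = Set.Ioc a b := by
    intro a ha b hab
    ext z
    simp only [Set.mem_preimage, Set.mem_Ioc]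
    have haM : a ∈ Set.Ici M := Set.mem_Ici.2 (by linarith)
    have hbM : b ∈ Set.Ici M := Set.mem_Ici.2 (by linarith)
    have hHa : B < H.eval a := hx0B.trans_le (hmono.monotoneOn (Set.mem_Ici.2 hx0.le) haM ha)
    by_cases hz : M ≤ z
    · rw [hmono.lt_iff_lt haM hz, hmono.le_iff_le hz hbM]
    · push Not at hz
      have := hBneg z hz.le
      constructor
      · intro h; linarith [h.1]
      · intro h; linarith [h.1, Set.mem_Ici.1 haM]
  have hconst : ∀ b, x0 < b → gaussPrim q b = gaussPrim q x0 := by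
    intro b hb
    have h3 := hq _ (measurableSet_Ioc (a := H.eval x0) (b := H.eval b))
    rw [hpre x0 le_rfl b hb.le, setIntegral_Ioc_gaussianReal q hb.le] at h3
    linarith
  refine eq_of_frequently_eval_eq (tendsto_id (x := atTop)) (Eventually.frequently ?_)
  filter_upwards [eventually_gt_atTop x0] with x hx
  have := HasDerivAt.eq_of_eqOn_Ioi (hasDerivAt_gaussPrim q x) (hasDerivAt_const x _) hx hconst
  simpa [(gaussianPDFReal_zero_one_pos x).ne'] using this

/-- The two branches of the inverse of a polynomial of even degree near `+∞`. -/
lemma exists_branches {H : ℝ[X]} (heven : Even H.natDegree) (hn : H.natDegree ≠ 0)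
    (hlc : 0 < H.leadingCoeff) :
    ∃ (B : ℝ) (u v : ℝ → ℝ), Tendsto u atTop atTop ∧
      ∀ y, B < y → 0 < u y ∧ v y < 0 ∧ H.eval (u y) = y ∧ H.eval (v y) = y ∧
        (derivative H).eval (u y) ≠ 0 ∧ (derivative H).eval (v y) ≠ 0 ∧
        HasDerivAt u ((derivative H).eval (u y))⁻¹ y ∧
        HasDerivAt v ((derivative H).eval (v y))⁻¹ y ∧
        (fun x => H.eval x) ⁻¹' (Set.Iic y) = Set.Icc (v y) (u y) := by
  have hn' : (H.comp (-X)).natDegree ≠ 0 := by rwa [natDegree_comp_neg_X]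
  have hlc' : 0 < (H.comp (-X)).leadingCoeff := by
    rwa [leadingCoeff_comp_neg_X, heven.neg_one_pow, mul_one]
  obtain ⟨M, ⟨h1, h2⟩, hM⟩ := (((eventually_forall_ge_derivative_pos hn hlc).and
    (eventually_forall_ge_derivative_pos hn' hlc')).and (eventually_gt_atTop 0)).exists
  have hmono := strictMonoOn_Ici_of_derivative_pos h1
  have hmono' := strictMonoOn_Ici_of_derivative_pos h2
  have hanti : StrictAntiOn (fun x => H.eval x) (Set.Iic (-M)) := by
    intro a ha b hb hab
    have := hmono' (Set.mem_Ici.2 (show M ≤ -b by linarith [Set.mem_Iic.1 hb]))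
      (Set.mem_Ici.2 (show M ≤ -a by linarith [Set.mem_Iic.1 ha])) (neg_lt_neg hab)
    simpa using this
  have h2' : ∀ x ≤ -M, (derivative H).eval x < 0 := by
    intro x hx
    have := h2 (-x) (by linarith)
    rw [eval_derivative_comp_neg_X, neg_neg] at this
    linarith
  obtain ⟨B, hB⟩ := (isCompact_Icc (a := -M) (b := M)).bddAbove_image
    (f := fun x => H.eval x) H.continuous.continuousOn
  have hB' : ∀ z, -M ≤ z → z ≤ M → H.eval z ≤ B := fun z h3 h4 =>
    hB ⟨z, ⟨h3, h4⟩, rfl⟩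
  have hu : ∀ y, B < y → ∃ x, M < x ∧ H.eval x = y := fun y hy =>
    exists_gt_eval_eq hn hlc ((hB' M (by linarith) le_rfl).trans_lt hy)
  have hv : ∀ y, B < y → ∃ x, x < -M ∧ H.eval x = y := by
    intro y hy
    obtain ⟨x, hx, hxy⟩ := exists_gt_eval_eq (M := M) (y := y) hn' hlc'
      (by simpa using (hB' (-M) le_rfl (by linarith)).trans_lt hy)
    exact ⟨-x, neg_lt_neg hx, by simpa using hxy⟩
  choose! u hu using hu
  choose! v hv using hv
  refine ⟨B, u, v, ?_, fun y hy => ?_⟩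
  · refine tendsto_atTop.2 fun K => ?_
    filter_upwards [eventually_gt_atTop B, eventually_ge_atTop (H.eval (max K M))] with y hy hK
    refine (le_max_left K M).trans ?_
    rw [← (hu y hy).2] at hK
    exact (hmono.le_iff_le (Set.mem_Ici.2 (le_max_right _ _))
      (Set.mem_Ici.2 (hu y hy).1.le)).1 hK
  · obtain ⟨huM, huy⟩ := hu y hy
    obtain ⟨hvM, hvy⟩ := hv y hy
    have hdu := (h1 _ huM.le).ne'
    have hdv := (h2' _ hvM.le).ne
    refine ⟨by linarith, by linarith, huy, hvy, hdu, hdv, ?_, ?_, ?_⟩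
    -- `u` is only a choice of root; injectivity of `H` on `[M, ∞)` makes it a local left inverse,
    -- which gives its derivative.
    · have h3 := (H.hasStrictDerivAt (u y)).to_local_left_inverse hdu (g := u) (by
        filter_upwards [eventually_gt_nhds huM,
          (continuousAt_const.eventually_lt H.continuous.continuousAt (by rw [huy]; exact hy) :
            ∀ᶠ x in 𝓝 (u y), B < H.eval x)] with x hx hxB
        exact hmono.injOn (Set.mem_Ici.2 (hu _ hxB).1.le) (Set.mem_Ici.2 hx.le) (hu _ hxB).2)
      simpa [huy] using h3.hasDerivAt
    · have h3 := (H.hasStrictDerivAt (v y)).to_local_left_inverse hdv (g := v) (by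
        filter_upwards [eventually_lt_nhds hvM,
          (continuousAt_const.eventually_lt H.continuous.continuousAt (by rw [hvy]; exact hy) :
            ∀ᶠ x in 𝓝 (v y), B < H.eval x)] with x hx hxB
        exact hanti.injOn (Set.mem_Iic.2 (hv _ hxB).1.le) (Set.mem_Iic.2 hx.le) (hv _ hxB).2)
      simpa [hvy] using h3.hasDerivAt
    · ext z
      simp only [Set.mem_preimage, Set.mem_Iic, Set.mem_Icc]
      have huM' : u y ∈ Set.Ici M := Set.mem_Ici.2 huM.le
      have hvM' : v y ∈ Set.Iic (-M) := Set.mem_Iic.2 hvM.le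
      by_cases hz : M ≤ z
      · have := hmono.le_iff_le (Set.mem_Ici.2 hz) huM'
        simp only [huy] at this
        rw [this]
        exact ⟨fun h => ⟨by linarith, h⟩, fun h => h.2⟩
      · push Not at hz
        by_cases hz' : z ≤ -M
        · have := hanti.le_iff_ge (Set.mem_Iic.2 hz') hvM'
          simp only [hvy] at this
          rw [this]
          exact ⟨fun h => ⟨h, by linarith⟩, fun h => h.1⟩
        · push Not at hz'
          have := hB' z hz'.le hz.le
          exact ⟨fun _ => ⟨by linarith, by linarith⟩, fun _ => by linarith⟩

/-- Up to a common positive factor, the numerator of the logarithmic derivative of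
`q φ / H'`, where `φ` is the standard Gaussian density. -/
def logDerivNum (H q : ℝ[X]) : ℝ[X] :=
  derivative q * derivative H - q * derivative (derivative H) - X * q * derivative H

lemma natDegree_logDerivNum {H q : ℝ[X]} (hn : H.natDegree ≠ 0) (hq : q ≠ 0) :
    (logDerivNum H q).natDegree = q.natDegree + H.natDegree := by
  have hH' := derivative_ne_zero_of_natDegree_ne_zero hn
  have h1 : (X * q * derivative H).natDegree = q.natDegree + H.natDegree := by
    rw [natDegree_mul (mul_ne_zero X_ne_zero hq) hH', natDegree_X_mul hq, natDegree_derivative]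
    omega
  have h2 : (derivative q * derivative H - q * derivative (derivative H)).natDegree ≤
      q.natDegree + (H.natDegree - 1) := by
    refine (natDegree_sub_le _ _).trans (max_le ?_ ?_)
    · exact natDegree_mul_le_of_le ((natDegree_derivative_le q).trans (Nat.sub_le _ _))
        (natDegree_derivative_le H)
    · exact natDegree_mul_le_of_le le_rfl (((natDegree_derivative_le _).trans
        (Nat.sub_le _ _)).trans (natDegree_derivative_le H))
  rw [logDerivNum, natDegree_sub_eq_right_of_natDegree_lt (by omega), h1]

lemma hasDerivAt_div_derivative {H q : ℝ[X]} {x : ℝ} (hx : (derivative H).eval x ≠ 0) :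
    HasDerivAt (fun x => q.eval x * gaussianPDFReal 0 1 x / (derivative H).eval x)
      ((logDerivNum H q).eval x * gaussianPDFReal 0 1 x / (derivative H).eval x ^ 2) x := by
  have h1 := ((q.hasDerivAt x).mul (hasDerivAt_gaussianPDFReal_zero_one x)).div
    ((derivative H).hasDerivAt x) hx
  refine h1.congr_deriv ?_
  simp only [logDerivNum, eval_sub, eval_mul, eval_X]
  congr 1
  simp only [Pi.mul_apply]
  ring

/-- Along the two branches, the density of `q` coincides, and so does its derivative. -/
lemma exists_branches_relations {H q : ℝ[X]} (heven : Even H.natDegree) (hn : H.natDegree ≠ 0)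
    (hlc : 0 < H.leadingCoeff)
    (hq : ∀ A : Set ℝ, MeasurableSet A →
      ∫ x in (fun x => H.eval x) ⁻¹' A, q.eval x ∂(gaussianReal 0 1) = 0) :
    ∃ u v : ℝ → ℝ, Tendsto u atTop atTop ∧ ∀ᶠ y in atTop, v y ≠ u y ∧
      H.eval (v y) = H.eval (u y) ∧
      (derivative H).eval (u y) ≠ 0 ∧ (derivative H).eval (v y) ≠ 0 ∧
      q.eval (u y) * gaussianPDFReal 0 1 (u y) / (derivative H).eval (u y) =
        q.eval (v y) * gaussianPDFReal 0 1 (v y) / (derivative H).eval (v y) ∧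
      (logDerivNum H q).eval (u y) * gaussianPDFReal 0 1 (u y) / (derivative H).eval (u y) ^ 3 =
        (logDerivNum H q).eval (v y) * gaussianPDFReal 0 1 (v y) /
          (derivative H).eval (v y) ^ 3 := by
  obtain ⟨B, u, v, hu, h⟩ := exists_branches heven hn hlc
  have hprim : ∀ y, B < y → gaussPrim q (u y) = gaussPrim q (v y) := by
    intro y hy
    obtain ⟨h1, h2, -, -, -, -, -, -, h3⟩ := h y hy
    -- The sublevel set `{H ≤ y}` is the single interval `[v y, u y]`, so the integral of `q` over
    -- it is a difference of primitives.
    have h4 := hq _ (measurableSet_Iic (a := y))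
    rw [h3, setIntegral_Icc_gaussianReal q (by linarith)] at h4
    linarith
  have hdens : ∀ y, B < y →
      q.eval (u y) * gaussianPDFReal 0 1 (u y) / (derivative H).eval (u y) =
        q.eval (v y) * gaussianPDFReal 0 1 (v y) / (derivative H).eval (v y) := by
    intro y hy
    obtain ⟨-, -, -, -, -, -, h3, h4, -⟩ := h y hy
    exact HasDerivAt.eq_of_eqOn_Ioi ((hasDerivAt_gaussPrim q (u y)).comp y h3)
      ((hasDerivAt_gaussPrim q (v y)).comp y h4) hy hprim
  refine ⟨u, v, hu, ?_⟩
  filter_upwards [eventually_gt_atTop B] with y hy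
  obtain ⟨h1, h2, h3, h4, h5, h6, h7, h8, -⟩ := h y hy
  refine ⟨by linarith, by rw [h3, h4], h5, h6, hdens y hy, ?_⟩
  have := HasDerivAt.eq_of_eqOn_Ioi
    (HasDerivAt.comp y (hasDerivAt_div_derivative (q := q) h5) h7)
    (HasDerivAt.comp y (hasDerivAt_div_derivative (q := q) h6) h8) hy hdens
  rw [← div_eq_mul_inv, ← div_eq_mul_inv, div_div, div_div, ← pow_succ, ← pow_succ] at this
  exact this

/-- Squaring the relation gives `(q(c - x) / q(x))² exp(2cx - c²) = 1` at arbitrarily large `x`. The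
rational factor tends to `1`, while the exponential tends to `0` or `∞` unless `c = 0`. -/
lemma reflection_center_eq_zero {ι : Type*} {l : Filter ι} {x : ι → ℝ} (hx : Tendsto x l atTop)
    {q : ℝ[X]} (hq : q ≠ 0) {c : ℝ}
    (h : ∃ᶠ i in l, q.eval (x i) * gaussianPDFReal 0 1 (x i) =
      -(q.eval (c - x i) * gaussianPDFReal 0 1 (c - x i))) : c = 0 := by
  set r : ℝ → ℝ := fun z => ((q.comp (C c - X)) ^ 2).eval z / (q ^ 2).eval z with hr
  have hr1 : Tendsto r atTop (𝓝 1) := by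
    have hnd : (C c - X : ℝ[X]).natDegree = 1 := by
      rw [← natDegree_neg, neg_sub, natDegree_X_sub_C]
    have hlcd : (C c - X : ℝ[X]).leadingCoeff = -1 := by
      rw [← neg_sub, leadingCoeff_neg, leadingCoeff_X_sub_C]
    have hd : ((q.comp (C c - X)) ^ 2).degree = (q ^ 2).degree := by
      have h0 : q.comp (C c - X) ≠ 0 := by
        intro h0
        have := congrArg leadingCoeff h0
        rw [leadingCoeff_comp (by omega), hlcd] at this
        simp [hq] at this
      rw [degree_eq_natDegree (pow_ne_zero _ h0), degree_eq_natDegree (pow_ne_zero _ hq),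
        natDegree_pow, natDegree_pow, natDegree_comp, hnd, mul_one]
    have := div_tendsto_atTop_leadingCoeff_div_of_degree_eq _ _ hd
    rw [leadingCoeff_pow, leadingCoeff_pow, leadingCoeff_comp (by omega), hlcd, mul_pow, ← pow_mul,
      mul_comm _ 2, pow_mul, neg_one_sq, one_pow, mul_one,
      div_self (pow_ne_zero _ (leadingCoeff_ne_zero.2 hq))] at this
    exact this
  have hfreq : ∃ᶠ i in l, r (x i) * Real.exp (2 * c * x i - c ^ 2) = 1 := by
    refine (h.and_eventually (eventually_eval_ne_zero hx hq)).mono fun i hi => ?_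
    obtain ⟨h1, h2⟩ := hi
    simp only [gaussianPDFReal_def] at h1
    have hs : (√(2 * Real.pi * ((1 : NNReal) : ℝ)))⁻¹ ≠ 0 := by positivity
    have h3 : q.eval (x i) * Real.exp (-(x i - 0) ^ 2 / (2 * ((1 : NNReal) : ℝ))) =
        -(q.eval (c - x i) * Real.exp (-(c - x i - 0) ^ 2 / (2 * ((1 : NNReal) : ℝ)))) := by
      refine mul_left_cancel₀ hs ?_
      linear_combination h1
    have h4 : q.eval (x i) ^ 2 * Real.exp (-(x i) ^ 2) =
        q.eval (c - x i) ^ 2 * Real.exp (-(c - x i) ^ 2) := by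
      have h5 := congrArg (· ^ 2) h3
      simp only [neg_sq, mul_pow, ← Real.exp_nat_mul] at h5
      convert h5 using 3 <;> simp <;> ring
    have h6 : Real.exp (2 * c * x i - c ^ 2) =
        Real.exp (-(c - x i) ^ 2) / Real.exp (-(x i) ^ 2) := by
      rw [← Real.exp_sub]; congr 1; ring
    rw [hr, h6]
    simp only [eval_pow, eval_comp, eval_sub, eval_C, eval_X]
    rw [div_mul_div_comm, ← h4, div_self]
    positivity
  by_contra hc
  rcases lt_or_gt_of_ne hc with hc | hc
  · have h1 : Tendsto (fun z => Real.exp (2 * c * z - c ^ 2)) atTop (𝓝 0) := by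
      refine Real.tendsto_exp_atBot.comp (tendsto_atBot_add_const_right _ _ ?_)
      exact tendsto_id.const_mul_atTop_of_neg (by linarith)
    have h2 := (hr1.mul h1).comp hx
    rw [one_mul] at h2
    obtain ⟨i, h3, h4⟩ := (hfreq.and_eventually (h2.eventually_lt_const one_pos)).exists
    exact h4.ne h3
  · have h1 : Tendsto (fun z => Real.exp (2 * c * z - c ^ 2)) atTop atTop := by
      refine Real.tendsto_exp_atTop.comp (tendsto_atTop_add_const_right _ _ ?_)
      exact tendsto_id.const_mul_atTop (by linarith)
    have h2 := (hr1.pos_mul_atTop one_pos h1).comp hx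
    obtain ⟨i, h3, h4⟩ := (hfreq.and_eventually (h2.eventually_gt_atTop 1)).exists
    exact h4.ne' h3

/-- Once the branches are known to satisfy `u + v = c` infinitely often, `H(v) = H(u)` and the
density relation become polynomial identities, which give the two parities. -/
lemma even_and_odd_of_setIntegral_eq_zero_of_even {H q : ℝ[X]} (heven : Even H.natDegree)
    (hn : H.natDegree ≠ 0) (hlc : 0 < H.leadingCoeff) (hq0 : q ≠ 0)
    (hq : ∀ A : Set ℝ, MeasurableSet A →
      ∫ x in (fun x => H.eval x) ⁻¹' A, q.eval x ∂(gaussianReal 0 1) = 0) :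
    H.comp (-X) = H ∧ q.comp (-X) = -q := by
  obtain ⟨u, v, hu, hrel⟩ := exists_branches_relations heven hn hlc hq
  have hn2 : 2 ≤ H.natDegree := by
    obtain ⟨k, hk⟩ := heven; omega
  have hH' := derivative_ne_zero_of_natDegree_ne_zero hn
  have hNdeg := natDegree_logDerivNum hn hq0
  have hN : logDerivNum H q ≠ 0 := by
    intro h0; rw [h0, natDegree_zero] at hNdeg; omega
  have hDdeg : (q * derivative H ^ 2).natDegree + 2 =
      (logDerivNum H q).natDegree + H.natDegree := by
    rw [natDegree_mul hq0 (pow_ne_zero _ hH'), natDegree_pow, natDegree_derivative, hNdeg]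
    omega
  -- Formally, dividing the differentiated density relation by the original one leaves `N / (q
  -- H'²)`, free of `φ`, with equal values at `u` and `v`. Cross-multiplication avoids dividing by
  -- values of `q`.
  obtain ⟨c, hc⟩ := exists_frequently_add_eq hu hn2 hN (mul_ne_zero hq0 (pow_ne_zero 2 hH')) hDdeg
    (hrel.mono fun y h => h.1) (hrel.mono fun y h => h.2.1) (by
      filter_upwards [hrel] with y h
      obtain ⟨-, -, h1, h2, h3, h4⟩ := h
      have hφu := (gaussianPDFReal_zero_one_pos (u y)).ne'
      have hφv := (gaussianPDFReal_zero_one_pos (v y)).ne'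
      rw [div_eq_div_iff h1 h2] at h3
      rw [div_eq_div_iff (pow_ne_zero 3 h1) (pow_ne_zero 3 h2)] at h4
      simp only [eval_mul, eval_pow]
      set a := (derivative H).eval (u y)
      set b := (derivative H).eval (v y)
      refine mul_left_cancel₀ (mul_ne_zero (mul_ne_zero hφu hφv) (mul_ne_zero h1 h2)) ?_
      linear_combination ((logDerivNum H q).eval (v y) * gaussianPDFReal 0 1 (v y) * a ^ 3) * h3 -
        (q.eval (v y) * gaussianPDFReal 0 1 (v y) * a) * h4)
  have hHc : H.comp (C c - X) = H := by
    refine eq_of_frequently_eval_eq hu ((hc.and_eventually hrel).mono fun y h => ?_)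
    simp [← h.1, h.2.2.1]
  have hc0 : c = 0 := by
    refine reflection_center_eq_zero hu hq0 ((hc.and_eventually hrel).mono fun y h => ?_)
    obtain ⟨h1, -, -, h2, h3, h4, -⟩ := h
    have h5 : (derivative H).eval (v y) = -(derivative H).eval (u y) := by
      have := congrArg (fun p => (derivative p).eval (u y)) hHc
      simp [derivative_comp, ← h1] at this
      linarith
    rw [h5, div_neg, ← neg_div] at h4
    have h6 := (div_left_inj' h2).1 h4
    rwa [h1] at h6
  subst hc0
  have hHe : H.comp (-X) = H := by simpa using hHc
  refine ⟨hHe, eq_of_frequently_eval_eq hu ((hc.and_eventually hrel).mono fun y h => ?_)⟩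
  obtain ⟨h1, -, -, h2, h3, h4, -⟩ := h
  rw [zero_sub] at h1
  have h5 : (derivative H).eval (v y) = -(derivative H).eval (u y) := by
    have := eval_derivative_comp_neg_X H (u y)
    rw [hHe] at this
    rw [h1, this, neg_neg]
  have hφ : gaussianPDFReal 0 1 (-u y) = gaussianPDFReal 0 1 (u y) := by
    simp [gaussianPDFReal_def]
  rw [h5, div_neg, ← neg_div] at h4
  have h6 := (div_left_inj' h2).1 h4
  rw [h1, hφ, ← neg_mul] at h6
  have h7 := mul_right_cancel₀ (gaussianPDFReal_zero_one_pos (u y)).ne' h6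
  simp [h7]

lemma eq_zero_or_parity_of_setIntegral_eq_zero_of_pos {H q : ℝ[X]} (hn : H.natDegree ≠ 0)
    (hlc : 0 < H.leadingCoeff)
    (hq : ∀ A : Set ℝ, MeasurableSet A →
      ∫ x in (fun x => H.eval x) ⁻¹' A, q.eval x ∂(gaussianReal 0 1) = 0) :
    q = 0 ∨ (H.comp (-X) = H ∧ q.comp (-X) = -q) := by
  by_cases hq0 : q = 0
  · exact Or.inl hq0
  rcases Nat.even_or_odd H.natDegree with h | h
  · exact Or.inr (even_and_odd_of_setIntegral_eq_zero_of_even h hn hlc hq0 hq)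
  · exact Or.inl (eq_zero_of_setIntegral_eq_zero_of_odd h hlc hq)

/-- If a polynomial `q` in a standard Gaussian variable has vanishing conditional expectation given
`H`, then `q = 0`, or `H` is even and `q` is odd. -/
theorem eq_zero_or_parity_of_setIntegral_eq_zero {H q : ℝ[X]} (hn : H.natDegree ≠ 0)
    (hq : ∀ A : Set ℝ, MeasurableSet A →
      ∫ x in (fun x => H.eval x) ⁻¹' A, q.eval x ∂(gaussianReal 0 1) = 0) :
    q = 0 ∨ (H.comp (-X) = H ∧ q.comp (-X) = -q) := by
  have hH0 : H ≠ 0 := by rintro rfl; simp at hn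
  rcases lt_or_gt_of_ne (leadingCoeff_ne_zero.2 hH0) with h | h
  · have := eq_zero_or_parity_of_setIntegral_eq_zero_of_pos (H := -H) (q := q)
      (by rwa [natDegree_neg]) (by rw [leadingCoeff_neg]; linarith) (fun A hA => by
        have := hq (Neg.neg ⁻¹' A) (hA.preimage measurable_neg)
        simp only [eval_neg]
        exact this)
    simpa using this
  · exact eq_zero_or_parity_of_setIntegral_eq_zero_of_pos hn h hq

/-! ### The Gamma operator in one variable -/

/-- Polynomials in one variable indexed by `Fin 1`, as univariate polynomials. -/
def toUni (R : Type*) [CommRing R] : MvPolynomial (Fin 1) R →ₐ[R] R[X] :=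
  MvPolynomial.aeval fun _ => X

lemma toUni_X {R : Type*} [CommRing R] (i : Fin 1) : toUni R (MvPolynomial.X i) = X := by
  simp [toUni]

lemma toUni_C {R : Type*} [CommRing R] (a : R) : toUni R (MvPolynomial.C a) = C a := by
  simp [toUni, algebraMap_eq]

lemma toUni_pderiv {R : Type*} [CommRing R] (f : MvPolynomial (Fin 1) R) :
    toUni R (MvPolynomial.pderiv 0 f) = derivative (toUni R f) := by
  induction f using MvPolynomial.induction_on with
  | C a => simp
  | add p q hp hq => simp [hp, hq]
  | mul_X p i hp =>
    obtain rfl := Subsingleton.elim i 0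
    simp [Derivation.leibniz, hp, toUni_X, mul_comm]

lemma aeval_toUni {R A : Type*} [CommRing R] [CommRing A] [Algebra R A] (z : Fin 1 → A)
    (f : MvPolynomial (Fin 1) R) : Polynomial.aeval (z 0) (toUni R f) = MvPolynomial.aeval z f := by
  have : (Polynomial.aeval (z 0)).comp (toUni R) = MvPolynomial.aeval z := by
    refine MvPolynomial.algHom_ext fun i => ?_
    obtain rfl := Subsingleton.elim i 0
    simp [toUni_X]
  exact DFunLike.congr_fun this f

lemma toUni_map {R S : Type*} [CommRing R] [CommRing S] (φ : R →+* S)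
    (f : MvPolynomial (Fin 1) R) : toUni S (MvPolynomial.map φ f) = (toUni R f).map φ := by
  induction f using MvPolynomial.induction_on with
  | C a => simp
  | add p q hp hq => simp [hp, hq]
  | mul_X p i hp => simp [hp, toUni_X]

lemma toUni_injective (R : Type*) [CommRing R] : Function.Injective (toUni R) := by
  have : Function.LeftInverse (Polynomial.aeval (MvPolynomial.X 0 : MvPolynomial (Fin 1) R))
      (toUni R) := by
    intro f
    rw [aeval_toUni (fun i => MvPolynomial.X i)]
    simp
  exact this.injective

lemma derivative_hermite_succ (n : ℕ) :
    derivative (hermite (n + 1)) = (n + 1 : ℤ[X]) * hermite n := by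
  induction n with
  | zero => simp
  | succ n ih =>
    rw [hermite_succ (n + 1), derivative_sub, derivative_mul, ih]
    simp only [derivative_X, derivative_mul, hermite_succ n, derivative_add,
      derivative_natCast, derivative_one]
    push_cast
    ring

lemma toUni_hermiteMv (α : Fin 1 →₀ ℕ) :
    toUni ℝ (hermiteMv 1 α) = (hermite (α 0)).map (Int.castRingHom ℝ) := by
  rw [hermiteMv, Fin.prod_univ_one]
  have h1 := Polynomial.aeval_algHom_apply ((toUni ℝ).restrictScalars ℤ)
    (MvPolynomial.X 0 : MvPolynomial (Fin 1) ℝ) (hermite (α 0))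
  simp only [AlgHom.coe_restrictScalars', toUni_X] at h1
  rw [← h1, Polynomial.aeval_def, eval₂_eq_sum_range, Polynomial.map, eval₂_eq_sum_range]
  simp

lemma ouInv_hermiteMv (d : ℕ) (α : Fin d →₀ ℕ) :
    ouInv d (hermiteMv d α) =
      if α = 0 then 0 else (-((∑ k, α k : ℕ) : ℝ)⁻¹) • hermiteMv d α := by
  have h1 : hermiteBasis d α = hermiteMv d α := Module.Basis.mk_apply _ _ α
  conv_lhs => rw [← h1, ouInv, Module.Basis.constr_basis]

/-- `b = H' u`, where `u` is a polynomial whose Gaussian divergence is `a - c`. -/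
def SteinRel (H a b : ℝ[X]) (c : ℝ) : Prop :=
  ∃ u : ℝ[X], b = derivative H * u ∧ X * u - derivative u = a - C c

/-- With `u = -(L⁻¹f)'`, the divergence `X u - u'` is `L L⁻¹ f`, that is `f` minus its mean. On the
Hermite basis `u` is `H_n` for `f = H_{n+1}`, and the identity is the Hermite recursion. -/
lemma divergence_derivative_ouInv (f : MvPolynomial (Fin 1) ℝ) :
    ∃ c : ℝ, X * -derivative (toUni ℝ (ouInv 1 f)) -
      derivative (-derivative (toUni ℝ (ouInv 1 f))) = toUni ℝ f - C c := by
  have hf := top_le_span_hermiteMv 1 (Submodule.mem_top (x := f))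
  induction hf using Submodule.span_induction with
  | mem x hx =>
    obtain ⟨α, rfl⟩ := hx
    rw [ouInv_hermiteMv]
    by_cases hα : α = 0
    · subst hα
      exact ⟨1, by simp [toUni_hermiteMv]⟩
    · have h0 : α 0 ≠ 0 := by
        intro h0
        refine hα (Finsupp.ext fun i => ?_)
        obtain rfl := Subsingleton.elim i 0
        simpa using h0
      obtain ⟨n, hn⟩ : ∃ n, α 0 = n + 1 := ⟨α 0 - 1, by omega⟩
      refine ⟨0, ?_⟩
      rw [if_neg hα, map_smul, toUni_hermiteMv, Fin.sum_univ_one, hn]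
      have hd : derivative ((hermite (n + 1)).map (Int.castRingHom ℝ)) =
          C ((n + 1 : ℕ) : ℝ) * (hermite n).map (Int.castRingHom ℝ) := by
        rw [derivative_map, derivative_hermite_succ]
        simp
      have hs : (hermite (n + 1)).map (Int.castRingHom ℝ) = X * (hermite n).map (Int.castRingHom ℝ)
          - derivative ((hermite n).map (Int.castRingHom ℝ)) := by
        rw [hermite_succ, derivative_map]
        simp
      have hc : C (-((n + 1 : ℕ) : ℝ)⁻¹) * C ((n + 1 : ℕ) : ℝ) = (-1 : ℝ[X]) := by
        rw [← C_mul, neg_mul, inv_mul_cancel₀ (by positivity)]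
        simp
      rw [smul_eq_C_mul, derivative_C_mul, hd, ← mul_assoc, hc, hs]
      simp
  | zero => exact ⟨0, by simp⟩
  | add x y _ _ hx hy =>
    obtain ⟨c, hc⟩ := hx
    obtain ⟨c', hc'⟩ := hy
    refine ⟨c + c', ?_⟩
    simp only [map_add, derivative_neg] at hc hc' ⊢
    linear_combination hc + hc'
  | smul a x _ hx =>
    obtain ⟨c, hc⟩ := hx
    refine ⟨a * c, ?_⟩
    simp only [map_smul, derivative_neg, smul_eq_C_mul, derivative_C_mul, C_mul] at hc ⊢
    linear_combination C a * hc

lemma exists_steinRel_gammaOp (h f : MvPolynomial (Fin 1) ℝ) :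
    ∃ c, SteinRel (toUni ℝ h) (toUni ℝ f) (toUni ℝ (gammaOp h f)) c := by
  obtain ⟨c, hc⟩ := divergence_derivative_ouInv f
  refine ⟨c, _, ?_, hc⟩
  simp [gammaOp, divInv, toUni_pderiv]

/-- Degrees differ on the two sides. This is uniqueness of the polynomial with a given Gaussian
divergence. -/
lemma eq_zero_of_X_mul_eq_derivative {v : ℝ[X]} (h : X * v = derivative v) : v = 0 := by
  by_contra hv
  have h1 := congrArg natDegree h
  rw [natDegree_X_mul hv, natDegree_derivative] at h1
  omega

/-- Evenness is preserved by the Gamma operator of an even target. -/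
lemma SteinRel.comp_neg_X {H a b : ℝ[X]} {c : ℝ} (hs : SteinRel H a b c) (hH : H.comp (-X) = H)
    (ha : a.comp (-X) = a) : b.comp (-X) = b := by
  obtain ⟨u, rfl, hu⟩ := hs
  have hH' : (derivative H).comp (-X) = -derivative H := by
    have := congrArg derivative hH
    simp [derivative_comp] at this
    exact neg_eq_iff_eq_neg.1 this
  have hu' : u.comp (-X) = -u := by
    have h1 := congrArg (fun p => p.comp (-X)) hu
    simp [ha] at h1
    -- For even `a`, the sum `u(-x) + u(x)` has zero divergence; so `u` is odd, like `H'`, and their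
    -- product is even.
    have h2 : u.comp (-X) + u = 0 := by
      refine eq_zero_of_X_mul_eq_derivative ?_
      simp [derivative_comp]
      linear_combination hu - h1
    linear_combination h2
  rw [mul_comp, hH', hu', neg_mul_neg]

/-! ### Integration by parts -/

lemma integrable_mul_gaussianPDFReal {f : ℝ → ℝ} (hf : Integrable f (gaussianReal 0 1)) :
    Integrable fun x => f x * gaussianPDFReal 0 1 x := by
  rw [gaussianReal_of_var_ne_zero 0 one_ne_zero,
    integrable_withDensity_iff_integrable_smul' (measurable_gaussianPDF 0 1)
      (ae_of_all _ fun x => gaussianPDF_lt_top)] at hf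
  simpa [toReal_gaussianPDF, mul_comm] using hf

/-- A test function `F 0` with its derivatives `F s`, all of them integrable against polynomials
when composed with `H`. -/
structure IsTestSeq (H : ℝ[X]) (F : ℕ → ℝ → ℝ) : Prop where
  hasDerivAt : ∀ s y, HasDerivAt (F s) (F (s + 1) y) y
  integrable : ∀ s (r : ℝ[X]), Integrable (fun x => r.eval x * F s (H.eval x)) (gaussianReal 0 1)

/-- The derivative of `u F⁽ˢ⁾(H) φ` integrates to zero. Taking `F = 1` identifies `c` as the
Gaussian mean of `a`. -/
lemma SteinRel.integral_eq {H a b : ℝ[X]} {c : ℝ} (hs : SteinRel H a b c) {F : ℕ → ℝ → ℝ}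
    (hF : IsTestSeq H F) (s : ℕ) :
    ∫ x, a.eval x * F s (H.eval x) ∂(gaussianReal 0 1) =
      c * ∫ x, F s (H.eval x) ∂(gaussianReal 0 1) +
        ∫ x, b.eval x * F (s + 1) (H.eval x) ∂(gaussianReal 0 1) := by
  obtain ⟨u, rfl, hu⟩ := hs
  have h1 := hF.integrable s
  have h2 := hF.integrable (s + 1)
  set W : ℝ → ℝ := fun x => (derivative H * u).eval x * F (s + 1) (H.eval x) -
    (a - C c).eval x * F s (H.eval x) with hW
  have hWi : Integrable W (gaussianReal 0 1) := (h2 _).sub (h1 _)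
  have hder : ∀ x, HasDerivAt (fun x => u.eval x * F s (H.eval x) * gaussianPDFReal 0 1 x)
      (W x * gaussianPDFReal 0 1 x) x := by
    intro x
    have := ((u.hasDerivAt x).mul ((hF.hasDerivAt s (H.eval x)).comp x (H.hasDerivAt x))).mul
      (hasDerivAt_gaussianPDFReal_zero_one x)
    refine this.congr_deriv ?_
    simp only [hW, ← hu, eval_mul, eval_sub, eval_X, Pi.mul_apply, Function.comp_apply]
    ring
  have h3 := integral_eq_zero_of_hasDerivAt_of_integrable hder (integrable_mul_gaussianPDFReal hWi)
    (integrable_mul_gaussianPDFReal (h1 u))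
  have h4 : ∫ x, W x ∂(gaussianReal 0 1) = 0 := by
    rw [integral_gaussianReal_eq_integral_smul one_ne_zero]
    simpa only [smul_eq_mul, mul_comm] using h3
  rw [hW, integral_sub (h2 _) (h1 _)] at h4
  have h5 : ∫ x, (a - C c).eval x * F s (H.eval x) ∂(gaussianReal 0 1) =
      ∫ x, a.eval x * F s (H.eval x) ∂(gaussianReal 0 1) -
        c * ∫ x, F s (H.eval x) ∂(gaussianReal 0 1) := by
    rw [← integral_const_mul, ← integral_sub (h1 _) (by simpa using h1 (C c))]
    simp [sub_mul]
  rw [h5] at h4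
  linarith

lemma sum_integral_eq {H : ℝ[X]} {g p : ℕ → ℝ[X]} {c : ℕ → ℝ} (hg0 : g 0 = 0)
    (hg : ∀ s, SteinRel H (g s + p s) (g (s + 1)) (c s)) {F : ℕ → ℝ → ℝ} (hF : IsTestSeq H F)
    (k : ℕ) :
    ∑ t ∈ Finset.range k, ∫ x, (p t).eval x * F t (H.eval x) ∂(gaussianReal 0 1) =
      ∑ s ∈ Finset.range k, c s * ∫ x, F s (H.eval x) ∂(gaussianReal 0 1) +
        ∫ x, (g k).eval x * F k (H.eval x) ∂(gaussianReal 0 1) := by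
  induction k with
  | zero => simp [hg0]
  | succ k ih =>
    have h1 := (hg k).integral_eq hF k
    have h2 : ∫ x, (g k + p k).eval x * F k (H.eval x) ∂(gaussianReal 0 1) =
        ∫ x, (g k).eval x * F k (H.eval x) ∂(gaussianReal 0 1) +
          ∫ x, (p k).eval x * F k (H.eval x) ∂(gaussianReal 0 1) := by
      rw [← integral_add (hF.integrable k _) (hF.integrable k _)]
      simp [add_mul]
    rw [Finset.sum_range_succ, Finset.sum_range_succ, ih]
    linarith

lemma isTestSeq_polynomial (H p : ℝ[X]) : IsTestSeq H fun s y => (derivative^[s] p).eval y where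
  hasDerivAt s y := by
    rw [Function.iterate_succ_apply']
    exact (derivative^[s] p).hasDerivAt y
  integrable s r := by
    simpa using integrable_eval_gaussianReal (r * (derivative^[s] p).comp H)

/-- Differentiation advances the phase by `π/2`, and boundedness reduces integrability to that of
polynomials. -/
lemma isTestSeq_cos (H : ℝ[X]) (a θ : ℝ) :
    IsTestSeq H fun s y => a ^ s * Real.cos (a * y + θ + s * (Real.pi / 2)) where
  hasDerivAt s y := by
    have h1 : HasDerivAt (fun y : ℝ => a * y + θ + s * (Real.pi / 2)) (a * 1) y :=
      (((hasDerivAt_id y).const_mul a).add_const _).add_const _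
    refine (h1.cos.const_mul (a ^ s)).congr_deriv ?_
    rw [show a * y + θ + ((s + 1 : ℕ) : ℝ) * (Real.pi / 2) =
      a * y + θ + s * (Real.pi / 2) + Real.pi / 2 by push_cast; ring, Real.cos_add_pi_div_two]
    ring
  integrable s r := by
    refine ((integrable_eval_gaussianReal r).const_mul (a ^ s)).mono
      (by fun_prop) (ae_of_all _ fun x => ?_)
    rw [norm_mul, norm_mul, norm_mul, mul_comm]
    have h1 := Real.abs_cos_le_one (a * H.eval x + θ + s * (Real.pi / 2))
    rw [← Real.norm_eq_abs] at h1
    refine mul_le_mul_of_nonneg_right ?_ (norm_nonneg _)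
    exact mul_le_of_le_one_right (norm_nonneg _) h1

/-- An integrable weight whose image under `Y` has vanishing Fourier transform has vanishing
integrals over the fibres of `Y`. -/
lemma setIntegral_preimage_eq_zero_of_integral_cos {Ω : Type*} [MeasurableSpace Ω] {μ : Measure Ω}
    {Y G : Ω → ℝ} (hY : Measurable Y) (hGm : Measurable G) (hG : Integrable G μ)
    (h : ∀ a θ : ℝ, ∫ x, G x * Real.cos (a * Y x + θ) ∂μ = 0) {A : Set ℝ} (hA : MeasurableSet A) :
    ∫ x in Y ⁻¹' A, G x ∂μ = 0 := by
  -- `ENNReal.ofReal` truncates at zero, so `ν G` and `ν (-G)` are the images of the positive and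
  -- negative parts of `G μ`. They are finite measures, to be matched through their characteristic
  -- functions.
  set ν : (Ω → ℝ) → Measure ℝ := fun f => (μ.withDensity fun x => ENNReal.ofReal (f x)).map Y
    with hν
  have hfin : ∀ f, Integrable f μ → IsFiniteMeasure (ν f) := by
    intro f hf
    have := isFiniteMeasure_withDensity_ofReal hf.2
    exact Measure.isFiniteMeasure_map _ _
  have hexp : ∀ a : ℝ, Measurable fun x => Complex.exp (a * Y x * Complex.I) := by
    intro a; fun_prop
  have hnorm : ∀ (a : ℝ) x, ‖Complex.exp (a * Y x * Complex.I)‖ = 1 := by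
    intro a x
    rw [← Complex.ofReal_mul, Complex.norm_exp_ofReal_mul_I]
  have hchar : ∀ f, Measurable f → ∀ a, charFun (ν f) a =
      ∫ x, (max (f x) 0 : ℝ) • Complex.exp (a * Y x * Complex.I) ∂μ := by
    intro f hf a
    rw [charFun_apply_real, hν]
    simp only
    rw [integral_map hY.aemeasurable (by fun_prop),
      integral_withDensity_eq_integral_toReal_smul (by fun_prop) (ae_of_all _ fun x => by simp)]
    simp only [ENNReal.toReal_ofReal']
  have hint : ∀ f : Ω → ℝ, Integrable f μ → ∀ a : ℝ,
      Integrable (fun x => f x • Complex.exp (a * Y x * Complex.I)) μ := by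
    intro f hf a
    refine hf.mono (hf.aestronglyMeasurable.smul (hexp a).aestronglyMeasurable)
      (ae_of_all _ fun x => ?_)
    rw [norm_smul, hnorm, mul_one]
  have heq : ν G = ν (fun x => -G x) := by
    have := hfin G hG
    have := hfin (fun x => -G x) hG.neg
    refine Measure.ext_of_charFun (funext fun a => ?_)
    rw [hchar G hGm, hchar (fun x => -G x) hGm.neg, ← sub_eq_zero,
      ← integral_sub (hint _ hG.pos_part a) (hint _ hG.neg_part a)]
    -- The phases `0` and `-π/2` supply the cosine and the sine of the exponential.
    have h1 : ∀ x, (max (G x) 0) • Complex.exp (a * Y x * Complex.I) -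
        (max (-G x) 0) • Complex.exp (a * Y x * Complex.I) =
        ((G x * Real.cos (a * Y x + 0) : ℝ) : ℂ) +
          ((G x * Real.cos (a * Y x + -(Real.pi / 2)) : ℝ) : ℂ) * Complex.I := by
      intro x
      have h2 : max (G x) 0 - max (-G x) 0 = G x := by
        rcases le_total (G x) 0 with h3 | h3
        · rw [max_eq_right h3, max_eq_left (by linarith)]; ring
        · rw [max_eq_left h3, max_eq_right (by linarith)]; ring
      rw [← sub_smul, h2, add_zero, ← sub_eq_add_neg, Real.cos_sub_pi_div_two,
        ← Complex.ofReal_mul, Complex.exp_mul_I, Complex.real_smul]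
      push_cast
      ring
    simp_rw [h1]
    have h4 : ∀ θ, Integrable (fun x => G x * Real.cos (a * Y x + θ)) μ := by
      intro θ
      refine hG.mono (by fun_prop) (ae_of_all _ fun x => ?_)
      rw [norm_mul]
      exact mul_le_of_le_one_right (norm_nonneg _) (Real.abs_cos_le_one _)
    rw [integral_add (h4 _).ofReal ((h4 _).ofReal.mul_const _), integral_mul_const,
      integral_complex_ofReal, integral_complex_ofReal, h, h]
    simp
  have h5 : ∀ f, ν f A = ∫⁻ x in Y ⁻¹' A, ENNReal.ofReal (f x) ∂μ := by
    intro f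
    rw [hν]
    simp only
    rw [Measure.map_apply hY hA, withDensity_apply _ (hY hA)]
  rw [integral_eq_lintegral_pos_part_sub_lintegral_neg_part hG.integrableOn, ← h5, ← h5, heq,
    sub_self]

/-- Testing against polynomials and trigonometric functions. -/
lemma chain_of_forall_isTestSeq {H : ℝ[X]} {g p : ℕ → ℝ[X]} {c : ℕ → ℝ} (hg0 : g 0 = 0)
    (hg : ∀ s, SteinRel H (g s + p s) (g (s + 1)) (c s)) {T : ℕ}
    (hT : ∀ F, IsTestSeq H F →
      ∑ t ∈ Finset.range (T + 1), ∫ x, (p t).eval x * F t (H.eval x) ∂(gaussianReal 0 1) = 0) :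
    (∀ t ≤ T, ∫ x, (g t + p t).eval x ∂(gaussianReal 0 1) = 0) ∧
    ∀ A : Set ℝ, MeasurableSet A →
      ∫ x in (fun x => H.eval x) ⁻¹' A, (g T + p T).eval x ∂(gaussianReal 0 1) = 0 := by
  have key : ∀ F, IsTestSeq H F →
      ∑ s ∈ Finset.range T, c s * ∫ x, F s (H.eval x) ∂(gaussianReal 0 1) +
        ∫ x, (g T + p T).eval x * F T (H.eval x) ∂(gaussianReal 0 1) = 0 := by
    intro F hF
    have h1 := hT F hF
    rw [Finset.sum_range_succ, sum_integral_eq hg0 hg hF] at h1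
    rw [add_assoc, ← integral_add (hF.integrable T _) (hF.integrable T _)] at h1
    simpa [add_mul] using h1
  have hpow : ∀ k, (∀ s, s < k → s < T → c s = 0) → k ≤ T →
      (if k < T then c k * k.factorial else
        (∫ x, (g T + p T).eval x ∂(gaussianReal 0 1)) * k.factorial) = 0 := by
    intro k hk hkT
    -- Testing against `y^k` isolates one unknown: derivatives of order above `k` vanish, lower ones
    -- carry coefficients already known to be zero, and the `k`-th is `k!`.
    have h1 := key _ (isTestSeq_polynomial H (X ^ k))
    have h2 : ∀ s, k < s → derivative^[s] (X ^ k : ℝ[X]) = 0 := fun s hs =>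
      iterate_derivative_eq_zero (by simpa using hs)
    have h3 : derivative^[k] (X ^ k : ℝ[X]) = C (k.factorial : ℝ) := by
      rw [iterate_derivative_X_pow_eq_C_mul, Nat.sub_self, pow_zero, mul_one,
        Nat.descFactorial_self]
    split_ifs with hlt
    · rw [h2 T hlt, Finset.sum_eq_single k] at h1
      · simpa [h3] using h1
      · intro s hs hne
        rcases lt_or_gt_of_ne hne with h4 | h4
        · rw [hk s h4 (Finset.mem_range.1 hs), zero_mul]
        · simp [h2 s h4]
      · exact fun h => absurd (Finset.mem_range.2 hlt) h
    · obtain rfl : k = T := by omega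
      rw [Finset.sum_eq_zero, h3, zero_add] at h1
      · simpa [integral_mul_const] using h1
      · intro s hs
        rw [hk s (Finset.mem_range.1 hs) (Finset.mem_range.1 hs), zero_mul]
  have hc : ∀ k, k < T → c k = 0 := by
    intro k
    induction k using Nat.strong_induction_on with
    | _ k ih =>
      intro hk
      have h1 := hpow k ih hk.le
      rw [if_pos hk] at h1
      simpa [Nat.factorial_ne_zero] using h1
  have hGT : ∫ x, (g T + p T).eval x ∂(gaussianReal 0 1) = 0 := by
    have h1 := hpow T (fun s _ => hc s) le_rfl
    rw [if_neg (lt_irrefl T)] at h1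
    simpa [Nat.factorial_ne_zero] using h1
  refine ⟨fun t ht => ?_, fun A hA => ?_⟩
  · rcases ht.lt_or_eq with ht | rfl
    · have h1 := (hg t).integral_eq (isTestSeq_polynomial H 1) 0
      simpa [hc t ht] using h1
    · exact hGT
  · refine setIntegral_preimage_eq_zero_of_integral_cos H.continuous.measurable
      (g T + p T).continuous.measurable (integrable_eval_gaussianReal _) (fun a θ => ?_) hA
    -- The frequency `0` is lost on differentiating `T` times, as `a ^ T` may vanish; there the mean
    -- of `g T + p T` is used instead.
    by_cases ha : a = 0
    · subst ha
      simp only [zero_mul, zero_add]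
      rw [integral_mul_const, hGT, zero_mul]
    -- The phase is shifted back so that the `T`-th derivative has phase `θ`.
    · have h1 := key _ (isTestSeq_cos H a (θ - T * (Real.pi / 2)))
      rw [Finset.sum_eq_zero fun s hs => by rw [hc s (Finset.mem_range.1 hs), zero_mul],
        zero_add] at h1
      have h2 : ∀ x, (g T + p T).eval x * (a ^ T * Real.cos (a * H.eval x +
          (θ - T * (Real.pi / 2)) + T * (Real.pi / 2))) =
          a ^ T * ((g T + p T).eval x * Real.cos (a * H.eval x + θ)) := by
        intro x
        rw [show a * H.eval x + (θ - T * (Real.pi / 2)) + T * (Real.pi / 2) =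
          a * H.eval x + θ by ring]
        ring
      simp_rw [h2] at h1
      rw [integral_const_mul] at h1
      exact (mul_eq_zero.1 h1).resolve_left (pow_ne_zero _ ha)

/-! ### The support of the law of a polynomial in a Gaussian variable -/

lemma eval_mem_support_map_gaussianReal (H : ℝ[X]) (x : ℝ) :
    H.eval x ∈ ((gaussianReal 0 1).map fun x => H.eval x).support := by
  rw [Measure.mem_support_iff_forall]
  intro U hU
  obtain ⟨V, hVU, hV, hxV⟩ := mem_nhds_iff.1 hU
  refine lt_of_lt_of_le ?_ (measure_mono hVU)
  rw [Measure.map_apply H.continuous.measurable hV.measurableSet, pos_iff_ne_zero]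
  intro h0
  have h1 := gaussianReal_absolutelyContinuous' 0 one_ne_zero h0
  exact ((hV.preimage H.continuous).measure_pos volume ⟨x, hxV⟩).ne' h1

lemma support_map_gaussianReal (H : ℝ[X]) :
    ((gaussianReal 0 1).map fun x => H.eval x).support = closure (Set.range fun x => H.eval x) := by
  refine subset_antisymm (Measure.support_subset_of_isClosed isClosed_closure ?_)
    (closure_minimal ?_ Measure.isClosed_support)
  · rw [mem_ae_iff, Measure.map_apply H.continuous.measurable isClosed_closure.measurableSet.compl,
      Set.preimage_compl, Set.compl_empty_iff.2, measure_empty]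
    exact Set.eq_univ_of_forall fun x => subset_closure ⟨x, rfl⟩
  · rintro _ ⟨x, rfl⟩
    exact eval_mem_support_map_gaussianReal H x

/-- The support is the closure of a nondegenerate interval. Hence derivatives within it agree with
ordinary derivatives for globally smooth test functions. -/
lemma uniqueDiffOn_support_map_gaussianReal {H : ℝ[X]} (hH : H.natDegree ≠ 0) :
    UniqueDiffOn ℝ ((gaussianReal 0 1).map fun x => H.eval x).support := by
  rw [support_map_gaussianReal]
  have hord : (Set.range fun x => H.eval x).OrdConnected :=
    (isPreconnected_range H.continuous).ordConnected
  refine uniqueDiffOn_convex hord.convex.closure ?_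
  obtain ⟨x, hx⟩ : ∃ x, H.eval x ≠ H.eval 0 := by
    by_contra! h
    refine hH (natDegree_eq_zero.2 ⟨H.eval 0, Polynomial.funext fun x => ?_⟩)
    rw [eval_C, h x]
  have hsub : Set.uIcc (H.eval x) (H.eval 0) ⊆ Set.range fun x => H.eval x :=
    hord.uIcc_subset ⟨x, rfl⟩ ⟨0, rfl⟩
  have hne : (interior (Set.uIcc (H.eval x) (H.eval 0))).Nonempty := by
    rw [Set.uIcc, interior_Icc, Set.nonempty_Ioo, min_lt_max]
    exact hx
  exact hne.mono (interior_mono (hsub.trans subset_closure))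

/-! ### Chains for a single Gaussian variable -/

section Chains

variable {K : Type*} [CommRing K] [Algebra K ℝ]

/-- The sequence `gₜ` of a chain given by infinitely many coefficients. -/
def chainSeq (h : MvPolynomial (Fin 1) K) (p : ℕ → K[X]) : ℕ → MvPolynomial (Fin 1) ℝ
  | 0 => 0
  | t + 1 => gammaOp (MvPolynomial.map (algebraMap K ℝ) h) (chainSeq h p t + compTarget h (p t))

lemma chainPoly_eq_chainSeq (h : MvPolynomial (Fin 1) K) (p : ℕ → K[X]) {T : ℕ}
    (t : Fin (T + 1)) : chainPoly h (fun t : Fin (T + 1) => p t) t = chainSeq h p t := by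
  induction t using Fin.induction with
  | zero => rfl
  | succ i ih =>
    rw [chainPoly, Fin.induction_succ, Fin.val_succ, chainSeq]
    rw [chainPoly] at ih
    rw [ih]
    rfl

lemma toUni_compTarget (h : MvPolynomial (Fin 1) K) (p : K[X]) :
    toUni ℝ (compTarget h p) =
      (p.map (algebraMap K ℝ)).comp (toUni ℝ (MvPolynomial.map (algebraMap K ℝ) h)) := by
  rw [compTarget, toUni_map, toUni_map, ← Polynomial.aeval_algHom_apply, ← comp_eq_aeval,
    Polynomial.map_comp]

lemma natDegree_toUni_ne_zero (hK : Function.Injective (algebraMap K ℝ))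
    {h : MvPolynomial (Fin 1) K} (hh : ∀ c : K, h ≠ MvPolynomial.C c) :
    (toUni ℝ (MvPolynomial.map (algebraMap K ℝ) h)).natDegree ≠ 0 := by
  intro h0
  rw [toUni_map, natDegree_map_eq_of_injective hK, natDegree_eq_zero] at h0
  obtain ⟨c, hc⟩ := h0
  refine hh c (toUni_injective K ?_)
  rw [← hc, toUni_C]

lemma exists_steinRel_chainSeq (h : MvPolynomial (Fin 1) K) (p : ℕ → K[X]) :
    ∃ c : ℕ → ℝ, ∀ s, SteinRel (toUni ℝ (MvPolynomial.map (algebraMap K ℝ) h))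
      (toUni ℝ (chainSeq h p s) + toUni ℝ (compTarget h (p s)))
      (toUni ℝ (chainSeq h p (s + 1))) (c s) := by
  have h1 : ∀ s, ∃ c, SteinRel (toUni ℝ (MvPolynomial.map (algebraMap K ℝ) h))
      (toUni ℝ (chainSeq h p s) + toUni ℝ (compTarget h (p s)))
      (toUni ℝ (chainSeq h p (s + 1))) c := by
    intro s
    rw [← map_add]
    exact exists_steinRel_gammaOp _ _
  choose c hc using h1
  exact ⟨c, hc⟩

/-- In one variable, a chain whose last term has vanishing conditional expectation is algebraic. -/
lemma chainSeq_add_eq_zero {h : MvPolynomial (Fin 1) K} {p : ℕ → K[X]} {T : ℕ}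
    (hn : (toUni ℝ (MvPolynomial.map (algebraMap K ℝ) h)).natDegree ≠ 0)
    (hq : ∀ A : Set ℝ, MeasurableSet A →
      ∫ x in (fun x => (toUni ℝ (MvPolynomial.map (algebraMap K ℝ) h)).eval x) ⁻¹' A,
        (toUni ℝ (chainSeq h p T) + toUni ℝ (compTarget h (p T))).eval x ∂(gaussianReal 0 1) = 0) :
    toUni ℝ (chainSeq h p T) + toUni ℝ (compTarget h (p T)) = 0 := by
  rcases eq_zero_or_parity_of_setIntegral_eq_zero hn hq with h0 | ⟨hH, hodd⟩
  · exact h0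
  · obtain ⟨c, hc⟩ := exists_steinRel_chainSeq h p
    have hp : ∀ t, (toUni ℝ (compTarget h (p t))).comp (-X) = toUni ℝ (compTarget h (p t)) := by
      intro t
      rw [toUni_compTarget, comp_assoc, hH]
    have hg : ∀ t, (toUni ℝ (chainSeq h p t)).comp (-X) = toUni ℝ (chainSeq h p t) := by
      intro t
      induction t with
      | zero => simp [chainSeq]
      | succ t ih => exact (hc t).comp_neg_X hH (by rw [add_comp, ih, hp])
    rw [add_comp, hg, hp, eq_neg_iff_add_eq_zero, ← two_mul] at hodd
    exact (mul_eq_zero.1 hodd).resolve_left two_ne_zero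

lemma evalRV_eq_eval {R Ω : Type*} [CommRing R] [Algebra R ℝ] (X : Fin 1 → Ω → ℝ)
    (q : MvPolynomial (Fin 1) R) (ω : Ω) :
    evalRV X q ω = (toUni ℝ (MvPolynomial.map (algebraMap R ℝ) q)).eval (X 0 ω) := by
  rw [evalRV, ← aeval_toUni (fun k => X k ω), toUni_map, Polynomial.eval_map, Polynomial.aeval_def]

lemma evalRV_real_eq_eval {Ω : Type*} (X : Fin 1 → Ω → ℝ) (q : MvPolynomial (Fin 1) ℝ) (ω : Ω) :
    evalRV X q ω = (toUni ℝ q).eval (X 0 ω) := by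
  rw [evalRV, ← aeval_toUni (fun k => X k ω), Polynomial.coe_aeval_eq_eval]

lemma aeval_evalRV_eq_eval {Ω : Type*} (X : Fin 1 → Ω → ℝ) (h : MvPolynomial (Fin 1) K)
    (p : K[X]) (ω : Ω) :
    Polynomial.aeval (evalRV X h ω) p = (toUni ℝ (compTarget h p)).eval (X 0 ω) := by
  rw [toUni_compTarget, eval_comp, ← evalRV_eq_eval, Polynomial.eval_map, Polynomial.aeval_def]

lemma evalRV_chainPoly_add {Ω : Type*} (X : Fin 1 → Ω → ℝ) (h : MvPolynomial (Fin 1) K)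
    (p : ℕ → K[X]) {T : ℕ} (t : Fin (T + 1)) (ω : Ω) :
    evalRV X (chainPoly h (fun t : Fin (T + 1) => p t) t) ω +
      Polynomial.aeval (evalRV X h ω) (p t) =
        (toUni ℝ (chainSeq h p t) + toUni ℝ (compTarget h (p t))).eval (X 0 ω) := by
  rw [chainPoly_eq_chainSeq, evalRV_real_eq_eval, aeval_evalRV_eq_eval, eval_add]

/-! ### Transfer between the random variable `X 0` and the standard Gaussian measure. -/

section RandomVariable

variable {Ω : Type*} [MeasurableSpace Ω] {P : Measure Ω} {X : Fin 1 → Ω → ℝ}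

lemma integral_comp_eq (hXm : Measurable (X 0)) (hX : P.map (X 0) = gaussianReal 0 1)
    {F : ℝ → ℝ} (hF : Measurable F) : ∫ ω, F (X 0 ω) ∂P = ∫ x, F x ∂(gaussianReal 0 1) := by
  rw [← hX, integral_map hXm.aemeasurable hF.aestronglyMeasurable]

lemma rvSupport_evalRV (hXm : Measurable (X 0)) (hX : P.map (X 0) = gaussianReal 0 1)
    (h : MvPolynomial (Fin 1) K) :
    rvSupport P (evalRV X h) = ((gaussianReal 0 1).map fun x =>
      (toUni ℝ (MvPolynomial.map (algebraMap K ℝ) h)).eval x).support := by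
  rw [rvSupport, ← hX, Measure.map_map (Polynomial.continuous _).measurable hXm]
  congr 2
  funext ω
  exact evalRV_eq_eval X h ω

lemma IsTestSeq.contDiff {H : ℝ[X]} {F : ℕ → ℝ → ℝ} (hF : IsTestSeq H F) (n s : ℕ) :
    ContDiff ℝ n (F s) := by
  induction n generalizing s with
  | zero =>
    exact contDiff_zero.2 (continuous_iff_continuousAt.2 fun y => (hF.hasDerivAt s y).continuousAt)
  | succ n ih =>
    have h1 : deriv (F s) = F (s + 1) := funext fun y => (hF.hasDerivAt s y).deriv
    push_cast
    rw [contDiff_succ_iff_deriv, h1]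
    exact ⟨fun y => (hF.hasDerivAt s y).differentiableAt, by simp, ih (s + 1)⟩

lemma IsTestSeq.iteratedDeriv_eq {H : ℝ[X]} {F : ℕ → ℝ → ℝ} (hF : IsTestSeq H F) (n : ℕ) :
    iteratedDeriv n (F 0) = F n := by
  induction n with
  | zero => exact iteratedDeriv_zero
  | succ n ih =>
    rw [iteratedDeriv_succ, ih]
    exact funext fun y => (hF.hasDerivAt n y).deriv

/-- A test sequence starts with a globally smooth function whose derivatives are integrable against
all polynomials, so it is admissible whatever the order and degree of `S`. Coefficients beyond the
order vanish, so the sum may run up to any such `T`. -/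
lemma sum_integral_eq_zero_of_mem_PSO (hXm : Measurable (X 0))
    (hX : P.map (X 0) = gaussianReal 0 1) {h : MvPolynomial (Fin 1) K}
    (hn : (toUni ℝ (MvPolynomial.map (algebraMap K ℝ) h)).natDegree ≠ 0) {S : ℕ →₀ K[X]}
    (hS : S ∈ PSO K P (evalRV X h)) {T : ℕ} (hT : order S ≤ T) {F : ℕ → ℝ → ℝ}
    (hF : IsTestSeq (toUni ℝ (MvPolynomial.map (algebraMap K ℝ) h)) F) :
    ∑ t ∈ Finset.range (T + 1), ∫ x, (toUni ℝ (compTarget h (S t))).eval x *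
      F t ((toUni ℝ (MvPolynomial.map (algebraMap K ℝ) h)).eval x) ∂(gaussianReal 0 1) = 0 := by
  set H := toUni ℝ (MvPolynomial.map (algebraMap K ℝ) h) with hH
  have hsupp := rvSupport_evalRV hXm hX h
  have hder : ∀ t ω, iteratedDerivWithin t (F 0) (rvSupport P (evalRV X h)) (evalRV X h ω) =
      F t (H.eval (X 0 ω)) := by
    intro t ω
    rw [hsupp, iteratedDerivWithin_eq_iteratedDeriv (uniqueDiffOn_support_map_gaussianReal hn)
      (hF.contDiff t 0).contDiffAt
      (by rw [evalRV_eq_eval]; exact eval_mem_support_map_gaussianReal _ _),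
      hF.iteratedDeriv_eq, evalRV_eq_eval]
  have hint : ∀ (r : ℝ[X]) t, Integrable (fun ω => r.eval (X 0 ω) * F t (H.eval (X 0 ω))) P := by
    intro r t
    have h1 := hF.integrable t r
    rw [← hX] at h1
    exact h1.comp_measurable hXm
  have hmem : F 0 ∈ testFunctions P (evalRV X h) S := by
    refine ⟨(hF.contDiff _ 0).contDiffOn, fun t _ j _ => ?_⟩
    simp only [hder]
    refine (hint (H ^ j) t).congr (ae_of_all _ fun ω => ?_)
    simp only [eval_pow, evalRV_eq_eval, ← hH]
  have h1 := (hS _ hmem).2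
  have h2 : ∀ ω, applyOp (rvSupport P (evalRV X h)) S (F 0) (evalRV X h ω) =
      ∑ t ∈ Finset.range (T + 1),
        (toUni ℝ (compTarget h (S t))).eval (X 0 ω) * F t (H.eval (X 0 ω)) := by
    intro ω
    rw [applyOp]
    simp only [hder, aeval_evalRV_eq_eval]
    refine Finset.sum_subset (fun t ht => ?_) fun t _ ht => ?_
    · exact Finset.mem_range_succ_iff.2 ((Finset.le_sup (f := id) ht).trans hT)
    · rw [Finsupp.notMem_support_iff.1 ht]
      simp [compTarget]
  simp_rw [h2] at h1
  rw [integral_finsetSum _ fun t _ => hint _ t] at h1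
  refine Eq.trans (Finset.sum_congr rfl fun t _ => ?_) h1
  have hm : Measurable (F t) := (hF.contDiff 0 t).continuous.measurable
  exact (integral_comp_eq hXm hX (F := fun x => (toUni ℝ (compTarget h (S t))).eval x *
    F t (H.eval x)) ((Polynomial.continuous _).measurable.mul
    (hm.comp H.continuous.measurable))).symm

lemma setIntegral_eq_zero_of_orthogonalTo (hXm : Measurable (X 0))
    (hX : P.map (X 0) = gaussianReal 0 1) [IsFiniteMeasure P] {h : MvPolynomial (Fin 1) K}
    {q : ℝ[X]} (hq : OrthogonalTo P (evalRV X h) fun ω => q.eval (X 0 ω)) {A : Set ℝ}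
    (hA : MeasurableSet A) :
    ∫ x in (fun x => (toUni ℝ (MvPolynomial.map (algebraMap K ℝ) h)).eval x) ⁻¹' A, q.eval x
      ∂(gaussianReal 0 1) = 0 := by
  set H := toUni ℝ (MvPolynomial.map (algebraMap K ℝ) h) with hH
  have hY : evalRV X h = fun ω => H.eval (X 0 ω) := funext fun ω => evalRV_eq_eval X h ω
  have hYm : Measurable (evalRV X h) := by
    rw [hY]; exact H.continuous.measurable.comp hXm
  have hind : Measurable (A.indicator fun _ => (1 : ℝ)) := measurable_const.indicator hA
  have h1 := hq.2 (fun ω => A.indicator (fun _ => (1 : ℝ)) (evalRV X h ω))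
    (hind.comp (comap_measurable _)) (MemLp.of_bound (hind.comp hYm).aestronglyMeasurable 1
      (ae_of_all _ fun ω => (norm_indicator_le_norm_self _ _).trans (by simp)))
  simp only [hY] at h1
  have h2 := integral_comp_eq hXm hX
    (F := fun x => q.eval x * A.indicator (fun _ => (1 : ℝ)) (H.eval x))
    (q.continuous.measurable.mul (hind.comp H.continuous.measurable))
  rw [h1] at h2
  rw [← integral_indicator (H.continuous.measurable hA)]
  refine Eq.trans ?_ h2.symm
  refine integral_congr_ae (ae_of_all _ fun x => ?_)
  by_cases hx : H.eval x ∈ A <;> simp [hx, Set.indicator]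

lemma SC_subset_ASC (hXm : Measurable (X 0)) (hX : P.map (X 0) = gaussianReal 0 1)
    [IsFiniteMeasure P] {h : MvPolynomial (Fin 1) K}
    (hn : (toUni ℝ (MvPolynomial.map (algebraMap K ℝ) h)).natDegree ≠ 0) (T : ℕ) :
    SC P X h T ⊆ ASC P X h T := by
  intro p hp
  refine ⟨hp, ae_of_all _ fun ω => ?_⟩
  -- The finite chain is extended by zero; `g_T` depends only on the coefficients before `T`.
  obtain ⟨p, rfl⟩ : ∃ p' : ℕ → K[X], p = fun t : Fin (T + 1) => p' t :=
    ⟨fun n => if hn : n < T + 1 then p ⟨n, hn⟩ else 0, funext fun t => by simp only [t.2, dif_pos]⟩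
  have h1 := hp.2
  simp only [evalRV_chainPoly_add] at h1 ⊢
  rw [chainSeq_add_eq_zero (T := (Fin.last T : ℕ)) hn fun A hA =>
    setIntegral_eq_zero_of_orthogonalTo hXm hX h1 hA, eval_zero]

lemma mem_ASC_of_mem_PSO (hXm : Measurable (X 0)) (hX : P.map (X 0) = gaussianReal 0 1)
    {h : MvPolynomial (Fin 1) K}
    (hn : (toUni ℝ (MvPolynomial.map (algebraMap K ℝ) h)).natDegree ≠ 0) {S : ℕ →₀ K[X]}
    (hS : S ∈ PSO K P (evalRV X h)) {T : ℕ} (hT : order S ≤ T) :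
    (fun t : Fin (T + 1) => S t) ∈ ASC P X h T := by
  obtain ⟨c, hc⟩ := exists_steinRel_chainSeq h S
  obtain ⟨hmean, hset⟩ := chain_of_forall_isTestSeq (by simp [chainSeq]) hc
    (fun F hF => sum_integral_eq_zero_of_mem_PSO hXm hX hn hS hT hF)
  have hzero := chainSeq_add_eq_zero hn hset
  have hlast : ∀ ω, evalRV X (chainPoly h (fun t : Fin (T + 1) => S t) (Fin.last T)) ω +
      Polynomial.aeval (evalRV X h ω) (S (Fin.last T : ℕ)) = 0 := by
    intro ω
    rw [evalRV_chainPoly_add, Fin.val_last, hzero, eval_zero]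
  refine ⟨⟨fun t => ?_, ?_⟩, ae_of_all _ hlast⟩
  · have h1 := hmean t (Nat.lt_succ_iff.1 t.2)
    simp only [chainPoly_eq_chainSeq, evalRV_real_eq_eval, aeval_evalRV_eq_eval]
    rw [integral_comp_eq hXm hX (Polynomial.continuous _).measurable,
      integral_comp_eq hXm hX (Polynomial.continuous _).measurable]
    simp only [eval_add] at h1
    rw [integral_add (integrable_eval_gaussianReal _) (integrable_eval_gaussianReal _)] at h1
    linarith
  -- Orthogonality is immediate because the last term is identically zero.
  · simp only [hlast]
    exact ⟨MemLp.zero', by simp⟩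

end RandomVariable

end Chains

end SteinOp

end

/-! ### The main theorem. -/

theorem mainTheorem3 {K : Type*} [CommRing K] [Algebra K ℝ]
    (hK : Function.Injective (algebraMap K ℝ))
    {Ω : Type*} [MeasurableSpace Ω] (P : Measure Ω) [IsProbabilityMeasure P]
    (d : ℕ) (X : Fin d → Ω → ℝ) (hXm : ∀ k, Measurable (X k))
    (hXlaw : ∀ k, P.map (X k) = gaussianReal 0 1) (hXind : iIndepFun X P)
    (h : MvPolynomial (Fin d) K) (hh : ∀ c : K, h ≠ MvPolynomial.C c) :
    SteinOp.APSO P X h ⊆ SteinOp.PSO K P (SteinOp.evalRV X h) ∧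
    (d = 1 →
      SteinOp.APSO P X h = SteinOp.PSO K P (SteinOp.evalRV X h) ∧
      (∀ T : ℕ, 1 ≤ T → SteinOp.APSOLength P X h T =
        {S | S ∈ SteinOp.PSO K P (SteinOp.evalRV X h) ∧ SteinOp.order S ≤ T}) ∧
      (∀ T : ℕ, 1 ≤ T → SteinOp.ASC P X h T = SteinOp.SC P X h T)) := by
  have hsub : SteinOp.APSO P X h ⊆ SteinOp.PSO K P (SteinOp.evalRV X h) := by
    rintro S ⟨T, -, hS, -⟩
    exact hS
  refine ⟨hsub, ?_⟩
  rintro rfl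
  have hn := SteinOp.natDegree_toUni_ne_zero hK hh
  refine ⟨subset_antisymm hsub fun S hS => ?_, fun T _ => ?_, fun T _ => ?_⟩
  -- The length must be at least `1`, also for operators of order `0`; the top coefficient may be
  -- zero.
  · exact ⟨max 1 (SteinOp.order S), le_max_left _ _, hS, le_max_right _ _,
      SteinOp.mem_ASC_of_mem_PSO (hXm 0) (hXlaw 0) hn hS (le_max_right _ _)⟩
  · ext S
    exact ⟨fun hS => ⟨hS.1, hS.2.1⟩, fun hS => ⟨hS.1, hS.2,
      SteinOp.mem_ASC_of_mem_PSO (hXm 0) (hXlaw 0) hn hS.1 hS.2⟩⟩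
  · exact subset_antisymm (fun p hp => hp.1) (SteinOp.SC_subset_ASC (hXm 0) (hXlaw 0) hn T)
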